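/- Let $F$ be a field, let $S=F[x_0,\dots,x_r]$ be the polynomial ring with its standard grading, let $M$ be a nonzero finitely generated $\mathbb Z$-graded $S$-module of (Krull) dimension $n$, let $d\ge 0$, and let $I\subset S$ be an ideal generated by forms of degree $d$ such that $M/IM$ has finite length. Write $\operatorname{reg}$ for the Castelnuovo–Mumford regularity, i.e. $\operatorname{reg} N=\sup_i (b_i(N)-i)$, where $b_i(N)$ is the largest degree of a generator of the $i$-th free module in the minimal graded free resolution of $N$, and $\operatorname{reg} 0=-\infty$. Then $$\operatorname{reg} M/I^tM\;\le\; td+\operatorname{reg} M+(n-1)(d-1)-1\qquad\text{for every integer } t>0.$$ Moreover, equality holds for every $t>0$ when $I$ is generated by a nonempty sequence of forms of degree $d$ that is a regular sequence on $M$. -/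

import Mathlib

noncomputable section

namespace GradedReg

variable {F : Type*} [Field F] {r : ℕ}

/-- `F[x_0, …, x_r]`, with its standard grading (every variable has degree `1`). -/
abbrev PolyRing (F : Type*) [Field F] (r : ℕ) : Type _ := MvPolynomial (Fin (r + 1)) F

/-- The homogeneous maximal ideal `(x_0, …, x_r)`. -/
def irrelevantIdeal (F : Type*) [Field F] (r : ℕ) : Ideal (PolyRing F r) :=
  Ideal.span (Set.range MvPolynomial.X)

/-- `p` is a form of the (possibly negative) degree `j`; for `j < 0` only `0` is one. -/
def IsForm (p : PolyRing F r) (j : ℤ) : Prop :=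
  p = 0 ∨ ∃ a : ℕ, (a : ℤ) = j ∧ p.IsHomogeneous a

section Modules

variable {M : Type*} [AddCommGroup M] [Module (PolyRing F r) M]

/-- The additive subgroups `𝓜 j`, `j ∈ ℤ`, make `M` a `ℤ`-graded module over `F[x_0, …, x_r]`. -/
structure IsGrading (𝓜 : ℤ → AddSubgroup M) : Prop where
  isInternal : DirectSum.IsInternal 𝓜
  smul_mem : ∀ (a : ℕ) (j : ℤ) (p : PolyRing F r) (x : M),
    p.IsHomogeneous a → x ∈ 𝓜 j → p • x ∈ 𝓜 (a + j)

/-- The induced grading of `M ⧸ N`: its piece of degree `j` is the image of `𝓜 j`. -/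
def quotientGrading (𝓜 : ℤ → AddSubgroup M) (N : Submodule (PolyRing F r) M) :
    ℤ → AddSubgroup (M ⧸ N) :=
  fun j => (𝓜 j).map N.mkQ.toAddMonoidHom

/-- A minimal graded free resolution
`⋯ → F_2 → F_1 → F_0 → M → 0` of `M` by free modules of finite rank.
`F_i` is free on `e_{i,0}, …, e_{i,rank i - 1}`, where `e_{i,k}` has degree `deg i k`; all maps are
homogeneous of degree `0`, and the image of `F_{i+1}` lies in `𝔪 F_i`. -/
structure MinimalGradedFreeResolution (𝓜 : ℤ → AddSubgroup M) where
  rank : ℕ → ℕ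
  deg : (i : ℕ) → Fin (rank i) → ℤ
  d : (i : ℕ) → (Fin (rank (i + 1)) → PolyRing F r) →ₗ[PolyRing F r] (Fin (rank i) → PolyRing F r)
  ε : (Fin (rank 0) → PolyRing F r) →ₗ[PolyRing F r] M
  d_graded : ∀ (i : ℕ) (k : Fin (rank (i + 1))) (l : Fin (rank i)),
    IsForm (d i (Pi.single k 1) l) (deg (i + 1) k - deg i l)
  ε_graded : ∀ k : Fin (rank 0), ε (Pi.single k 1) ∈ 𝓜 (deg 0 k)
  exact_d : ∀ i : ℕ, Function.Exact (d (i + 1)) (d i)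
  exact_ε : Function.Exact (d 0) ε
  surjective_ε : Function.Surjective ε
  minimal : ∀ i : ℕ, LinearMap.range (d i) ≤
    irrelevantIdeal F r • (⊤ : Submodule (PolyRing F r) (Fin (rank i) → PolyRing F r))

/-- The supremum over `i` of (the largest degree of a generator of `F_i`) `- i`. -/
def MinimalGradedFreeResolution.regularity {𝓜 : ℤ → AddSubgroup M}
    (R : MinimalGradedFreeResolution (F := F) (r := r) 𝓜) : EReal :=
  ⨆ (i : ℕ) (k : Fin (R.rank i)), (((R.deg i k : ℝ) - (i : ℝ) : ℝ) : EReal)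

variable (F r) in
/-- The Castelnuovo–Mumford regularity of a finitely generated graded module, read off its minimal
graded free resolution. The infimum only serves to pick the resolution, which is unique up to
isomorphism. The zero module has regularity `-∞`. -/
def regularity (𝓜 : ℤ → AddSubgroup M) : EReal :=
  ⨅ R : MinimalGradedFreeResolution (F := F) (r := r) 𝓜, R.regularity

end Modules

end GradedReg

end

/-!
Regularity is computed through Koszul homology. `Kreg F r 𝓜 c` says that the Koszul homology
`H_p(x_0, …, x_r; M)` vanishes in all degrees larger than `c + p`. Shifting dimensions along the
syzygies of a minimal graded free resolution shows that this holds if and only if all generators of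
the `i`-th free module have degree at most `c + i` (`MinimalGradedFreeResolution.kreg` and
`MinimalGradedFreeResolution.deg_le`); as minimal resolutions exist, regularities can be compared
through Koszul homology (`regularity_le_add`). Two kinds of consequences are used:

* a module without elements of degree larger than `c` is `c`-regular, and if `M` is `c`-regular, then
  its elements killed by a power of the irrelevant ideal have degree at most `c`, because top Koszul
  homology is the socle (`Kreg.eq_zero_of_mem_irrelevantTorsion`);
* if `y` is a form of degree `d > 0` and a nonzerodivisor on `M`, then `M ⧸ y M` is
  `(c + d - 1)`-regular if and only if `M` is `c`-regular (`Kreg.quotient_smul_top`,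
  `Kreg.of_quotient_smul_top`); for "only if" one uses that `y` acts as zero on Koszul homology.

Upper bound. `M ⧸ I ^ t M` vanishes in large degrees, so one has to bound its degrees. Over an
infinite field this is an induction on the dimension (`mem_pow_smul_top_of_infinite`). The torsion of
`M` has degrees at most `reg M`, and dividing it out leaves a module on which `I` contains a
nonzerodivisor `y` of degree `d`, by prime avoidance. The dimension of `M ⧸ y M` is smaller and its
regularity is at most `reg M + d - 1`, and the exact sequence
`(M ⧸ I ^ (t - 1) M)(-d) → M ⧸ I ^ t M → M' ⧸ I ^ t M' → 0` with `M' = M ⧸ y M` gives the bound by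
induction on `t`. Over a finite field one first extends the base field to its algebraic closure
(`mem_pow_smul_top`), which preserves Koszul homology and does not increase the dimension.

Equality. If `I` is generated by the regular sequence `f_1, …, f_m`, then `M ⧸ I ^ t M` maps onto
`M ⧸ (f_1, …, f_{m - 1}, f_m ^ t) M`, whose regularity is
`reg M + (m - 1) (d - 1) + (t d - 1)` (`kreg_of_isWeaklyRegular`), and `dim M ≤ m`, since
`M` is finite over the polynomial ring in `f_1, …, f_m` (`IsGrading.supportDim_le_length`).
-/

noncomputable section

namespace GradedReg

section

variable {F : Type*} [Field F] {r : ℕ}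

/-! ### Forms and homogeneous components -/

theorem isForm_iff {p : PolyRing F r} {j : ℤ} :
    IsForm p j ↔ ∀ α, p.coeff α ≠ 0 → (α.degree : ℤ) = j := by
  constructor
  · rintro (rfl | ⟨a, rfl, hp⟩) α hα
    · simp at hα
    · have := hp hα
      rw [Finsupp.degree_eq_weight_one]
      exact_mod_cast this
  · intro h
    by_cases hp : p = 0
    · exact Or.inl hp
    · obtain ⟨α, hα⟩ := MvPolynomial.ne_zero_iff.1 hp
      refine Or.inr ⟨α.degree, h α hα, ?_⟩
      intro β hβ
      have h1 := h β hβ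
      have h2 := h α hα
      have h3 : β.degree = α.degree := by exact_mod_cast h1.trans h2.symm
      rw [← h3, Finsupp.degree_eq_weight_one]
      rfl

theorem isForm_natCast {p : PolyRing F r} {a : ℕ} : IsForm p (a : ℤ) ↔ p.IsHomogeneous a := by
  constructor
  · rintro (rfl | ⟨b, hb, hp⟩)
    · exact MvPolynomial.isHomogeneous_zero _ _ _
    · rwa [← Nat.cast_inj (R := ℤ) |>.1 hb]
  · intro h
    exact Or.inr ⟨a, rfl, h⟩

section Modules

variable {M : Type*} [AddCommGroup M] [Module (PolyRing F r) M] {𝓜 : ℤ → AddSubgroup M}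

theorem IsGrading.of_indep
    (ind : ∀ (s : Finset ℤ) (f : ℤ → M), (∀ j, f j ∈ 𝓜 j) → ∑ j ∈ s, f j = 0 → ∀ j ∈ s, f j = 0)
    (span : ∀ x, x ∈ ⨆ j, 𝓜 j)
    (smul_mem : ∀ (a : ℕ) (j : ℤ) (p : PolyRing F r) (x : M),
      p.IsHomogeneous a → x ∈ 𝓜 j → p • x ∈ 𝓜 (a + j)) : IsGrading (F := F) (r := r) 𝓜 := by
  classical
  refine ⟨⟨?_, ?_⟩, smul_mem⟩
  · rw [injective_iff_map_eq_zero]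
    intro x hx
    rw [DirectSum.coeAddMonoidHom_eq_dfinsuppSum, DFinsupp.sum] at hx
    have := ind x.support (fun j => (x j : M)) (fun j => (x j).2) hx
    ext j
    by_cases hj : j ∈ x.support
    · simpa using this j hj
    · simp only [DFinsupp.mem_support_toFun, ne_eq, not_not] at hj
      simp [hj]
  · intro x
    have h : (⨆ j, 𝓜 j) ≤ (DirectSum.coeAddMonoidHom 𝓜).range := by
      refine iSup_le fun j y hy => ⟨DirectSum.of (fun j => 𝓜 j) j ⟨y, hy⟩, ?_⟩
      simp
    exact h (span x)

namespace IsGrading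

/-- `M` as the direct sum of its homogeneous pieces. -/
def decomp (h : IsGrading (F := F) (r := r) 𝓜) : (DirectSum ℤ fun j => 𝓜 j) ≃+ M :=
  AddEquiv.ofBijective (DirectSum.coeAddMonoidHom 𝓜) (by exact h.isInternal)

/-- The homogeneous component of degree `j`. -/
def proj (h : IsGrading (F := F) (r := r) 𝓜) (j : ℤ) : M →+ M where
  toFun x := (h.decomp.symm x j : M)
  map_zero' := by simp
  map_add' x y := by simp

variable (h : IsGrading (F := F) (r := r) 𝓜)
include h

theorem proj_mem (j : ℤ) (x : M) : h.proj j x ∈ 𝓜 j := (h.decomp.symm x j).2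

theorem symm_of_mem {j : ℤ} {x : M} (hx : x ∈ 𝓜 j) :
    h.decomp.symm x = DirectSum.of (fun j => 𝓜 j) j ⟨x, hx⟩ := by
  rw [AddEquiv.symm_apply_eq]
  exact (DirectSum.coeAddMonoidHom_of 𝓜 j ⟨x, hx⟩).symm

theorem proj_of_mem {j : ℤ} {x : M} (hx : x ∈ 𝓜 j) : h.proj j x = x := by
  change (h.decomp.symm x j : M) = x
  rw [h.symm_of_mem hx, DirectSum.of_eq_same]

theorem proj_of_mem_ne {i j : ℤ} {x : M} (hx : x ∈ 𝓜 i) (hij : i ≠ j) : h.proj j x = 0 := by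
  change (h.decomp.symm x j : M) = 0
  rw [h.symm_of_mem hx, DirectSum.of_eq_of_ne _ _ _ hij.symm]
  rfl

theorem exists_sum_proj (x : M) : ∃ s : Finset ℤ, x = ∑ j ∈ s, h.proj j x := by
  classical
  refine ⟨(h.decomp.symm x).support, ?_⟩
  have h1 : DirectSum.coeAddMonoidHom 𝓜 (h.decomp.symm x) = x := h.decomp.apply_symm_apply x
  conv_lhs => rw [← h1, DirectSum.coeAddMonoidHom_eq_dfinsuppSum, DFinsupp.sum]
  rfl

@[elab_as_elim]
theorem induction {p : M → Prop} (zero : p 0) (add : ∀ x y, p x → p y → p (x + y))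
    (hom : ∀ j, ∀ x ∈ 𝓜 j, p x) (x : M) : p x := by
  classical
  obtain ⟨s, hs⟩ := h.exists_sum_proj x
  rw [hs]
  exact Finset.sum_induction _ p add zero fun j _ => hom j _ (h.proj_mem j x)

theorem proj_smul {a : ℕ} {p : PolyRing F r} (hp : p.IsHomogeneous a) (j : ℤ) (x : M) :
    h.proj (a + j) (p • x) = p • h.proj j x := by
  induction x using h.induction with
  | zero => simp
  | add x y hx hy => rw [smul_add, map_add, hx, hy, map_add, smul_add]
  | hom i x hx =>
    have h1 := h.smul_mem a i p x hp hx
    by_cases hij : i = j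
    · subst hij
      rw [h.proj_of_mem hx, h.proj_of_mem h1]
    · rw [h.proj_of_mem_ne hx hij, h.proj_of_mem_ne h1 (by simpa using hij), smul_zero]

theorem proj_smul' {a : ℕ} {p : PolyRing F r} (hp : p.IsHomogeneous a) (j : ℤ) (x : M) :
    h.proj j (p • x) = p • h.proj (j - a) x := by
  rw [← h.proj_smul hp, add_sub_cancel]

/-- A homomorphism of degree `0` commutes with taking components. -/
theorem proj_map {N : Type*} [AddCommGroup N] [Module (PolyRing F r) N] {𝓝 : ℤ → AddSubgroup N}
    (h' : IsGrading (F := F) (r := r) 𝓝) (f : M →+ N) (hf : ∀ j, ∀ x ∈ 𝓜 j, f x ∈ 𝓝 j)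
    (j : ℤ) (x : M) : h'.proj j (f x) = f (h.proj j x) := by
  induction x using h.induction with
  | zero => simp
  | add x y hx hy => simp only [map_add, hx, hy]
  | hom i x hx =>
    by_cases hij : i = j
    · subst hij
      rw [h.proj_of_mem hx, h'.proj_of_mem (hf _ _ hx)]
    · rw [h.proj_of_mem_ne hx hij, h'.proj_of_mem_ne (hf _ _ hx) hij, map_zero]

theorem sum_eq_zero {s : Finset ℤ} {f : ℤ → M} (hf : ∀ j, f j ∈ 𝓜 j) {N : Submodule (PolyRing F r) M}
    (hN : ∀ x ∈ N, ∀ j, h.proj j x ∈ N) (hs : ∑ j ∈ s, f j ∈ N) {j : ℤ} (hj : j ∈ s) : f j ∈ N := by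
  classical
  have := hN _ hs j
  rw [map_sum, Finset.sum_eq_single_of_mem j hj
    (fun i _ hij => h.proj_of_mem_ne (hf i) hij), h.proj_of_mem (hf j)] at this
  exact this

/-- The quotient by a homogeneous submodule is graded. -/
theorem quotient {N : Submodule (PolyRing F r) M} (hN : ∀ x ∈ N, ∀ j, h.proj j x ∈ N) :
    IsGrading (F := F) (r := r) (quotientGrading 𝓜 N) := by
  refine of_indep ?_ ?_ ?_
  · intro s f hf hs j hj
    choose g hg hgf using hf
    have h1 : ∑ j ∈ s, g j ∈ N := by
      rw [← Submodule.Quotient.mk_eq_zero, ← Submodule.mkQ_apply, map_sum, ← hs]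
      exact Finset.sum_congr rfl fun i _ => hgf i
    rw [← hgf j]
    exact (Submodule.Quotient.mk_eq_zero N).2 (h.sum_eq_zero hg hN h1 hj)
  · intro x
    obtain ⟨x, rfl⟩ := N.mkQ_surjective x
    induction x using h.induction with
    | zero => simp
    | add x y hx hy => rw [map_add]; exact add_mem hx hy
    | hom j x hx => exact AddSubgroup.mem_iSup_of_mem j ⟨x, hx, rfl⟩
  · rintro a j p _ hp ⟨x, hx, rfl⟩
    exact ⟨p • x, h.smul_mem a j p x hp hx, by simp⟩

/-- A homogeneous submodule is graded. -/
theorem submodule {N : Submodule (PolyRing F r) M} (hN : ∀ x ∈ N, ∀ j, h.proj j x ∈ N) :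
    IsGrading (F := F) (r := r) (fun j => (𝓜 j).comap N.subtype.toAddMonoidHom) := by
  refine of_indep ?_ ?_ ?_
  · intro s f hf hs j hj
    have h1 : ∑ j ∈ s, (f j : M) ∈ (⊥ : Submodule (PolyRing F r) M) := by
      rw [Submodule.mem_bot, ← Submodule.coe_sum, hs, Submodule.coe_zero]
    have := h.sum_eq_zero (f := fun j => (f j : M)) hf (N := ⊥) (by simp) h1 hj
    simpa using this
  · intro x
    obtain ⟨s, hs⟩ := h.exists_sum_proj x.1
    have : x = ∑ j ∈ s, (⟨h.proj j x.1, hN _ x.2 j⟩ : N) := by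
      ext
      rw [Submodule.coe_sum]
      exact hs
    rw [this]
    exact sum_mem fun j _ => AddSubgroup.mem_iSup_of_mem j (h.proj_mem j x.1)
  · intro a j p x hp hx
    exact h.smul_mem a j p x.1 hp hx

end IsGrading

/-- An element of `I M`, for `I` generated by forms of degree `d`, which is homogeneous of degree `j`
is a sum of products of the generators with elements of degree `j - d`. -/
theorem IsGrading.mem_closure_of_mem_span_smul (h : IsGrading (F := F) (r := r) 𝓜) {d : ℕ}
    {s : Set (PolyRing F r)} (hs : ∀ f ∈ s, f.IsHomogeneous d) {x : M} {j : ℤ}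
    (hx : x ∈ Ideal.span s • (⊤ : Submodule (PolyRing F r) M)) (hxj : x ∈ 𝓜 j) :
    x ∈ AddSubgroup.closure {y | ∃ f ∈ s, ∃ m ∈ 𝓜 (j - d), y = f • m} := by
  suffices H : ∀ x ∈ Ideal.span s • (⊤ : Submodule (PolyRing F r) M),
      h.proj j x ∈ AddSubgroup.closure {y | ∃ f ∈ s, ∃ m ∈ 𝓜 (j - d), y = f • m} by
    simpa [h.proj_of_mem hxj] using H x hx
  intro x hx
  refine Submodule.smul_induction_on hx ?_ ?_
  · intro p hp m _
    induction hp using Submodule.span_induction generalizing m with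
    | mem f hf =>
      refine AddSubgroup.subset_closure ⟨f, hf, _, h.proj_mem (j - d) m, ?_⟩
      rw [h.proj_smul' (hs f hf)]
    | zero => simp
    | add p q _ _ hp hq => rw [add_smul, map_add]; exact add_mem (hp _ trivial) (hq _ trivial)
    | smul a p _ hp => rw [smul_eq_mul, mul_comm, mul_smul]; exact hp _ trivial
  · intro x y hx hy
    rw [map_add]
    exact add_mem hx hy

/-- If `I` is generated by forms of degree `d`, then `I N` is homogeneous when `N` is. -/
theorem IsGrading.homogeneous_smul (h : IsGrading (F := F) (r := r) 𝓜) {d : ℕ}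
    {s : Set (PolyRing F r)} (hs : ∀ f ∈ s, f.IsHomogeneous d) {N : Submodule (PolyRing F r) M}
    (hN : ∀ x ∈ N, ∀ j, h.proj j x ∈ N) :
    ∀ x ∈ Ideal.span s • N, ∀ j, h.proj j x ∈ Ideal.span s • N := by
  intro x hx j
  refine Submodule.smul_induction_on hx ?_ ?_
  · intro p hp m hm
    induction hp using Submodule.span_induction generalizing m with
    | mem f hf =>
      rw [h.proj_smul' (hs f hf)]
      exact Submodule.smul_mem_smul (Ideal.subset_span hf) (hN _ hm _)
    | zero => simp
    | add p q _ _ hp hq => rw [add_smul, map_add]; exact add_mem (hp _ hm) (hq _ hm)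
    | smul a p _ hp =>
      rw [smul_eq_mul, mul_comm, mul_smul]; exact hp _ (N.smul_mem _ hm)
  · intro x y hx hy
    rw [map_add]
    exact add_mem hx hy

theorem IsGrading.homogeneous_pow_smul_top (h : IsGrading (F := F) (r := r) 𝓜) {d : ℕ}
    {s : Set (PolyRing F r)} (hs : ∀ f ∈ s, f.IsHomogeneous d) (t : ℕ) :
    ∀ x ∈ Ideal.span s ^ t • (⊤ : Submodule (PolyRing F r) M), ∀ j,
      h.proj j x ∈ Ideal.span s ^ t • (⊤ : Submodule (PolyRing F r) M) := by
  induction t with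
  | zero => simp
  | succ t ih =>
    rw [pow_succ', Submodule.mul_smul]
    exact h.homogeneous_smul hs ih

end Modules

/-- The grading of the free module on generators of degrees `deg l`. -/
def freeGrading (F : Type*) [Field F] (r : ℕ) {n : ℕ} (deg : Fin n → ℤ) :
    ℤ → AddSubgroup (Fin n → PolyRing F r) := fun j =>
  { carrier := {v | ∀ l, IsForm (v l) (j - deg l)}
    zero_mem' := fun _ => Or.inl rfl
    add_mem' := by
      intro v w hv hw l
      rw [isForm_iff]
      intro α hα
      simp only [Pi.add_apply, MvPolynomial.coeff_add] at hα
      by_cases h : (v l).coeff α = 0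
      · exact isForm_iff.1 (hw l) α (by simpa [h] using hα)
      · exact isForm_iff.1 (hv l) α h
    neg_mem' := by
      intro v hv l
      rw [isForm_iff]
      intro α hα
      exact isForm_iff.1 (hv l) α (by simpa using hα) }

theorem isGrading_freeGrading {n : ℕ} (deg : Fin n → ℤ) :
    IsGrading (F := F) (r := r) (freeGrading F r deg) := by
  refine IsGrading.of_indep ?_ ?_ ?_
  · intro s f hf hs j hj
    funext l
    ext α
    by_contra hα
    have h1 := isForm_iff.1 (hf j l) α hα
    have h2 := congrArg (fun v => (v l).coeff α) hs
    simp only [Finset.sum_apply, MvPolynomial.coeff_sum, Pi.zero_apply, MvPolynomial.coeff_zero] at h2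
    rw [Finset.sum_eq_single_of_mem j hj] at h2
    · exact hα h2
    · intro i _ hij
      by_contra h3
      have := isForm_iff.1 (hf i l) α h3
      omega
  · intro v
    have : v = ∑ l, Pi.single l (v l) := (Finset.univ_sum_single v).symm
    rw [this]
    refine sum_mem fun l _ => ?_
    rw [(v l).as_sum]
    have h2 : (Pi.single l (∑ α ∈ (v l).support, MvPolynomial.monomial α ((v l).coeff α)) :
        Fin n → PolyRing F r) =
        ∑ α ∈ (v l).support, Pi.single l (MvPolynomial.monomial α ((v l).coeff α)) :=
      map_sum (AddMonoidHom.single (fun _ : Fin n => PolyRing F r) l) _ _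
    rw [h2]
    refine sum_mem fun α _ => AddSubgroup.mem_iSup_of_mem (α.degree + deg l) fun k => ?_
    by_cases hk : k = l
    · subst hk
      rw [Pi.single_eq_same, isForm_iff]
      intro β hβ
      rw [MvPolynomial.coeff_monomial] at hβ
      split_ifs at hβ with hh
      · subst hh; ring
      · simp at hβ
    · rw [Pi.single_eq_of_ne hk]
      exact Or.inl rfl
  · intro a j p v hp hv l
    rcases hv l with h | ⟨b, hb, h⟩
    · left
      rw [Pi.smul_apply, h, smul_zero]
    · right
      exact ⟨a + b, by push_cast; omega, hp.mul h⟩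

end

/-! ### Koszul complexes -/

/-- The index set of a basis of the exterior algebra on `k` generators, that is, the subsets of
`{0, …, k - 1}`: those without `k - 1` on the left, those with it on the right. -/
def KIdx : ℕ → Type
  | 0 => Unit
  | k + 1 => KIdx k ⊕ KIdx k

/-- The exterior degree of a basis element. -/
def kdeg : (k : ℕ) → KIdx k → ℕ
  | 0, _ => 0
  | k + 1, Sum.inl T => kdeg k T
  | k + 1, Sum.inr T => kdeg k T + 1

instance instFiniteKIdx : (k : ℕ) → Finite (KIdx k)
  | 0 => inferInstanceAs (Finite Unit)
  | k + 1 => by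
    have := instFiniteKIdx k
    exact inferInstanceAs (Finite (KIdx k ⊕ KIdx k))

theorem kdeg_le : (k : ℕ) → (T : KIdx k) → kdeg k T ≤ k
  | 0, _ => le_rfl
  | k + 1, Sum.inl T => (kdeg_le k T).trans (Nat.le_succ k)
  | k + 1, Sum.inr T => Nat.succ_le_succ (kdeg_le k T)

section Koszul

variable {A : Type*} [CommRing A] {M : Type*} [AddCommGroup M] [Module A M]

/-- An element of the `(k + 1)`-st Koszul complex given by its two parts. -/
def kpair {M : Type*} {k : ℕ} (u v : KIdx k → M) : KIdx (k + 1) → M := Sum.elim u v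

/-- The part of an element of the `(k + 1)`-st Koszul complex not involving the last generator. -/
def kfst {M : Type*} {k : ℕ} (z : KIdx (k + 1) → M) : KIdx k → M := fun T => z (Sum.inl T)

/-- The part of an element of the `(k + 1)`-st Koszul complex involving the last generator. -/
def ksnd {M : Type*} {k : ℕ} (z : KIdx (k + 1) → M) : KIdx k → M := fun T => z (Sum.inr T)

@[simp] theorem kfst_kpair {M : Type*} {k : ℕ} (u v : KIdx k → M) : kfst (kpair u v) = u := rfl
@[simp] theorem ksnd_kpair {M : Type*} {k : ℕ} (u v : KIdx k → M) : ksnd (kpair u v) = v := rfl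
@[simp] theorem kfst_add {k : ℕ} (u v : KIdx (k + 1) → M) : kfst (u + v) = kfst u + kfst v := rfl
@[simp] theorem ksnd_add {k : ℕ} (u v : KIdx (k + 1) → M) : ksnd (u + v) = ksnd u + ksnd v := rfl
@[simp] theorem kfst_zero {k : ℕ} : kfst (0 : KIdx (k + 1) → M) = 0 := rfl
@[simp] theorem ksnd_zero {k : ℕ} : ksnd (0 : KIdx (k + 1) → M) = 0 := rfl
@[simp] theorem kfst_smul {k : ℕ} (c : A) (u : KIdx (k + 1) → M) : kfst (c • u) = c • kfst u := rfl
@[simp] theorem ksnd_smul {k : ℕ} (c : A) (u : KIdx (k + 1) → M) : ksnd (c • u) = c • ksnd u := rfl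

theorem kpair_ext {M : Type*} {k : ℕ} {z w : KIdx (k + 1) → M} (h1 : kfst z = kfst w)
    (h2 : ksnd z = ksnd w) : z = w := by
  funext T
  rcases T with T | T
  · exact congrFun h1 T
  · exact congrFun h2 T

/-- The differential of the Koszul complex of `a 0, …, a (k - 1)` on `M`, all exterior degrees
together. The `(k + 1)`-st complex is the mapping cone of `a k` on the `k`-th one. -/
def kd (a : ℕ → A) : (k : ℕ) → (KIdx k → M) →ₗ[A] (KIdx k → M)
  | 0 => 0
  | k + 1 =>
    { toFun := fun z => kpair (kd a k (kfst z) + a k • ksnd z) (-kd a k (ksnd z))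
      map_add' := fun z w => kpair_ext
        (by simp only [kfst_kpair, kfst_add, ksnd_add, map_add, smul_add]; abel)
        (by simp only [ksnd_kpair, ksnd_add, map_add, neg_add])
      map_smul' := fun c z => kpair_ext
        (by simp only [kfst_kpair, kfst_smul, ksnd_smul, map_smul, smul_add, RingHom.id_apply,
              smul_comm c (a k)])
        (by simp only [ksnd_kpair, ksnd_smul, map_smul, smul_neg, RingHom.id_apply]) }

@[simp] theorem kfst_kd (a : ℕ → A) (k : ℕ) (z : KIdx (k + 1) → M) :
    kfst (kd a (k + 1) z) = kd a k (kfst z) + a k • ksnd z := rfl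
@[simp] theorem ksnd_kd (a : ℕ → A) (k : ℕ) (z : KIdx (k + 1) → M) :
    ksnd (kd a (k + 1) z) = -kd a k (ksnd z) := rfl

theorem kd_kd (a : ℕ → A) (k : ℕ) (z : KIdx k → M) : kd a k (kd a k z) = 0 := by
  induction k with
  | zero => rfl
  | succ k ih =>
    refine kpair_ext ?_ ?_
    · simp [ih]
    · simp [ih]

/-- The Koszul differential is natural in the module and the elements. -/
theorem kd_comp {B : Type*} [CommRing B] {N : Type*} [AddCommGroup N] [Module B N]
    (a : ℕ → A) (b : ℕ → B) (φ : M →+ N) (hφ : ∀ i x, φ (a i • x) = b i • φ x) (k : ℕ)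
    (z : KIdx k → M) : kd b k (fun T => φ (z T)) = fun T => φ (kd a k z T) := by
  induction k with
  | zero => funext T; exact (map_zero φ).symm
  | succ k ih =>
    refine kpair_ext ?_ ?_
    · funext T
      have := congrFun (ih (kfst z)) T
      change kd b k (fun T => φ (kfst z T)) T + b k • φ (ksnd z T)
        = φ (kd a k (kfst z) T + a k • ksnd z T)
      rw [this, map_add, hφ]
    · funext T
      have := congrFun (ih (ksnd z)) T
      change -kd b k (fun T => φ (ksnd z T)) T = φ (-kd a k (ksnd z) T)
      rw [this, map_neg]

/-- Multiplication by the `i`-th exterior generator: the homotopy that shows that `a i` acts as zero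
on Koszul homology. -/
def kh (M : Type*) [AddCommGroup M] (i : ℕ) : (k : ℕ) → (KIdx k → M) → (KIdx k → M)
  | 0 => fun _ => 0
  | k + 1 => fun z => if i = k then kpair 0 (kfst z) else kpair (kh M i k (kfst z)) (-kh M i k (ksnd z))

theorem kh_add (i k : ℕ) (z w : KIdx k → M) : kh M i k (z + w) = kh M i k z + kh M i k w := by
  induction k with
  | zero => simp [kh]
  | succ k ih =>
    simp only [kh]
    split_ifs
    · exact kpair_ext (by simp) (by simp)
    · exact kpair_ext (by simp [ih]) (by simp [ih]; abel)

theorem kh_zero (i k : ℕ) : kh M i k 0 = 0 := by simpa using kh_add (M := M) i k 0 0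

theorem kh_neg (i k : ℕ) (z : KIdx k → M) : kh M i k (-z) = -kh M i k z := by
  rw [eq_neg_iff_add_eq_zero, ← kh_add, neg_add_cancel, kh_zero]

theorem kh_smul (i k : ℕ) (c : A) (z : KIdx k → M) : kh M i k (c • z) = c • kh M i k z := by
  induction k with
  | zero => simp [kh]
  | succ k ih =>
    simp only [kh]
    split_ifs
    · exact kpair_ext (by simp) (by simp)
    · exact kpair_ext (by simp [ih]) (by simp [ih])

theorem kd_kh_add_kh_kd (a : ℕ → A) (i k : ℕ) (hi : i < k) (z : KIdx k → M) :
    kd a k (kh M i k z) + kh M i k (kd a k z) = a i • z := by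
  induction k with
  | zero => omega
  | succ k ih =>
    simp only [kh]
    split_ifs with hik
    · subst hik
      exact kpair_ext (by simp) (by simp)
    · have hi' : i < k := by omega
      refine kpair_ext ?_ ?_
      · simp only [kfst_add, kfst_kd, kfst_kpair, ksnd_kpair, kfst_smul, kh_add, kh_smul, smul_neg,
          ← ih hi' (kfst z)]
        abel
      · simp only [ksnd_add, ksnd_kd, ksnd_kpair, ksnd_smul, kh_neg, neg_neg, map_neg,
          ← ih hi' (ksnd z)]

end Koszul

section Graded

variable {A : Type*} [CommRing A] {M : Type*} [AddCommGroup M] [Module A M]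

/-- The elements of exterior degree `p` and total degree `j`: the coefficients of the basis
elements of exterior degree `p` have degree `j - p`, the others vanish. -/
def kchain (𝓜 : ℤ → AddSubgroup M) (k p : ℕ) (j : ℤ) : AddSubgroup (KIdx k → M) where
  carrier := {z | ∀ T, (kdeg k T = p → z T ∈ 𝓜 (j - p)) ∧ (kdeg k T ≠ p → z T = 0)}
  zero_mem' := fun _ => ⟨fun _ => zero_mem _, fun _ => rfl⟩
  add_mem' := fun hz hw T => ⟨fun hT => add_mem ((hz T).1 hT) ((hw T).1 hT),
    fun hT => by rw [Pi.add_apply, (hz T).2 hT, (hw T).2 hT, add_zero]⟩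
  neg_mem' := fun hz T => ⟨fun hT => neg_mem ((hz T).1 hT),
    fun hT => by rw [Pi.neg_apply, (hz T).2 hT, neg_zero]⟩

variable {𝓜 : ℤ → AddSubgroup M}

theorem mem_kchain {k p : ℕ} {j : ℤ} {z : KIdx k → M} :
    z ∈ kchain 𝓜 k p j ↔ ∀ T, (kdeg k T = p → z T ∈ 𝓜 (j - p)) ∧ (kdeg k T ≠ p → z T = 0) :=
  Iff.rfl

theorem mem_kchain_succ {k p : ℕ} {j : ℤ} {z : KIdx (k + 1) → M} :
    z ∈ kchain 𝓜 (k + 1) (p + 1) j ↔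
      kfst z ∈ kchain 𝓜 k (p + 1) j ∧ ksnd z ∈ kchain 𝓜 k p (j - 1) := by
  have e : j - ((p + 1 : ℕ) : ℤ) = j - 1 - p := by push_cast; ring
  constructor
  · intro h
    refine ⟨fun T => h (Sum.inl T), fun T => ?_⟩
    have := h (Sum.inr T)
    rw [e] at this
    exact ⟨fun hT => this.1 (congrArg (· + 1) hT), fun hT => this.2 fun h' => hT (Nat.succ_injective h')⟩
  · rintro ⟨h1, h2⟩ (T | T)
    · exact h1 T
    · rw [e]
      exact ⟨fun hT => (h2 T).1 (Nat.succ_injective hT), fun hT => (h2 T).2 fun h' =>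
        hT (congrArg (· + 1) h')⟩

theorem mem_kchain_succ_zero {k : ℕ} {j : ℤ} {z : KIdx (k + 1) → M} :
    z ∈ kchain 𝓜 (k + 1) 0 j ↔ kfst z ∈ kchain 𝓜 k 0 j ∧ ksnd z = 0 := by
  constructor
  · intro h
    exact ⟨fun T => h (Sum.inl T), funext fun T => (h (Sum.inr T)).2 (Nat.succ_ne_zero _)⟩
  · rintro ⟨h1, h2⟩ (T | T)
    · exact h1 T
    · exact ⟨fun hT => absurd hT (Nat.succ_ne_zero _), fun _ => congrFun h2 T⟩

theorem kd_of_mem_zero (a : ℕ → A) {k : ℕ} {j : ℤ} {z : KIdx k → M} (hz : z ∈ kchain 𝓜 k 0 j) :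
    kd a k z = 0 := by
  induction k with
  | zero => rfl
  | succ k ih =>
    rw [mem_kchain_succ_zero] at hz
    exact kpair_ext (by simp [ih hz.1, hz.2]) (by simp [hz.2])

theorem kd_mem (a : ℕ → A) (ha : ∀ i j, ∀ x ∈ 𝓜 j, a i • x ∈ 𝓜 (j + 1)) {k p : ℕ} {j : ℤ}
    {z : KIdx k → M} (hz : z ∈ kchain 𝓜 k (p + 1) j) : kd a k z ∈ kchain 𝓜 k p j := by
  have smul : ∀ {k p : ℕ} {j : ℤ} {z : KIdx k → M} (i : ℕ), z ∈ kchain 𝓜 k p (j - 1) →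
      a i • z ∈ kchain 𝓜 k p j := by
    intro k p j z i hz T
    refine ⟨fun hT => ?_, fun hT => ?_⟩
    · have := ha i _ _ ((hz T).1 hT)
      rwa [show j - 1 - (p : ℤ) + 1 = j - p by ring] at this
    · rw [Pi.smul_apply, (hz T).2 hT, smul_zero]
  induction k generalizing p j with
  | zero => exact zero_mem _
  | succ k ih =>
    rw [mem_kchain_succ] at hz
    cases p with
    | zero =>
      rw [mem_kchain_succ_zero]
      refine ⟨?_, ?_⟩
      · rw [kfst_kd]
        exact add_mem (ih hz.1) (smul k hz.2)
      · rw [ksnd_kd, kd_of_mem_zero a hz.2, neg_zero]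
    | succ p =>
      rw [mem_kchain_succ]
      refine ⟨?_, ?_⟩
      · rw [kfst_kd]
        exact add_mem (ih hz.1) (smul k hz.2)
      · rw [ksnd_kd]
        exact neg_mem (ih hz.2)

theorem kh_mem (i : ℕ) {k p : ℕ} {j : ℤ} {z : KIdx k → M} (hz : z ∈ kchain 𝓜 k p j) :
    kh M i k z ∈ kchain 𝓜 k (p + 1) (j + 1) := by
  induction k generalizing p j with
  | zero => exact zero_mem _
  | succ k ih =>
    rw [mem_kchain_succ]
    simp only [kh]
    cases p with
    | zero =>
      rw [mem_kchain_succ_zero] at hz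
      split_ifs
      · exact ⟨zero_mem _, by simpa using hz.1⟩
      · refine ⟨ih hz.1, ?_⟩
        rw [hz.2, ksnd_kpair, kh_zero, neg_zero]
        exact zero_mem _
    | succ p =>
      rw [mem_kchain_succ] at hz
      split_ifs
      · exact ⟨zero_mem _, by simpa using hz.1⟩
      · refine ⟨ih hz.1, ?_⟩
        have := neg_mem (ih hz.2)
        simpa using this

/-- The Koszul homology of `a 0, …, a (k - 1)` on `M` vanishes in exterior degree `p` and total
degree `j`. -/
def KVan (a : ℕ → A) (k : ℕ) (𝓜 : ℤ → AddSubgroup M) (p : ℕ) (j : ℤ) : Prop :=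
  ∀ z ∈ kchain 𝓜 k p j, kd a k z = 0 → ∃ w ∈ kchain 𝓜 k (p + 1) j, kd a k w = z

theorem KVan.of_forall_eq_zero (a : ℕ → A) (k p : ℕ) {j : ℤ} (h : ∀ x ∈ 𝓜 (j - p), x = 0) :
    KVan a k 𝓜 p j := by
  intro z hz _
  refine ⟨0, zero_mem _, ?_⟩
  rw [map_zero]
  funext T
  by_cases hT : kdeg k T = p
  · exact (h _ ((hz T).1 hT)).symm
  · exact ((hz T).2 hT).symm

/-- `M` as the part of exterior degree `0` of the Koszul complex. -/
def kbot : (k : ℕ) → M → KIdx k → M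
  | 0 => fun m _ => m
  | k + 1 => fun m => kpair (kbot k m) 0

theorem kbot_mem {k : ℕ} {j : ℤ} {m : M} (hm : m ∈ 𝓜 j) : kbot k m ∈ kchain 𝓜 k 0 j := by
  induction k with
  | zero => exact fun T => ⟨fun _ => by
      rw [Nat.cast_zero, sub_zero]; exact hm, fun h => absurd rfl h⟩
  | succ k ih => exact mem_kchain_succ_zero.2 ⟨ih, rfl⟩

theorem exists_eq_kbot {k : ℕ} {j : ℤ} {z : KIdx k → M} (hz : z ∈ kchain 𝓜 k 0 j) :
    ∃ m ∈ 𝓜 j, z = kbot k m := by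
  induction k with
  | zero => exact ⟨z (), by simpa using (hz ()).1 rfl, rfl⟩
  | succ k ih =>
    rw [mem_kchain_succ_zero] at hz
    obtain ⟨m, hm, h⟩ := ih hz.1
    exact ⟨m, hm, kpair_ext h hz.2⟩

theorem kbot_add (k : ℕ) (m n : M) : kbot k (m + n) = kbot k m + kbot k n := by
  induction k with
  | zero => rfl
  | succ k ih => exact kpair_ext ih (add_zero 0).symm

theorem kbot_zero (k : ℕ) : kbot k (0 : M) = 0 := by simpa using kbot_add k (0 : M) 0

theorem kbot_neg (k : ℕ) (m : M) : kbot k (-m) = -kbot k m := by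
  rw [eq_neg_iff_add_eq_zero, ← kbot_add, neg_add_cancel, kbot_zero]

theorem kbot_smul (k : ℕ) (c : A) (m : M) : kbot k (c • m) = c • kbot k m := by
  induction k with
  | zero => rfl
  | succ k ih => exact kpair_ext ih (smul_zero c).symm

theorem kbot_map {N : Type*} [AddCommGroup N] (φ : M →+ N) (k : ℕ) (m : M) :
    (fun T => φ (kbot k m T)) = kbot k (φ m) := by
  induction k with
  | zero => rfl
  | succ k ih => exact kpair_ext ih (funext fun _ => map_zero φ)

/-- `M` as the part of top exterior degree of the Koszul complex. -/
def ktop : (k : ℕ) → M → KIdx k → M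
  | 0 => fun m _ => m
  | k + 1 => fun m => kpair 0 (ktop k m)

/-- Koszul homology in top exterior degree is the submodule of elements killed by all `a i`. -/
theorem eq_zero_of_kvan_top {a : ℕ → A} {k : ℕ} {j : ℤ} {m : M} (hm : m ∈ 𝓜 j)
    (ha : ∀ i < k, a i • m = 0) (h : KVan a k 𝓜 k (j + k)) : m = 0 := by
  have h1 : ∀ k, ktop k m ∈ kchain 𝓜 k k (j + k) := by
    intro k
    induction k with
    | zero => exact fun T => ⟨fun _ => by
        rw [Nat.cast_zero, add_zero, sub_zero]; exact hm, fun h => absurd rfl h⟩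
    | succ k ih =>
      refine mem_kchain_succ.2 ⟨zero_mem _, ?_⟩
      rw [show j + ((k + 1 : ℕ) : ℤ) - 1 = j + k by push_cast; ring]
      exact ih
  have smul : ∀ (k : ℕ) (c : A), c • ktop k m = ktop k (c • m) := by
    intro k c
    induction k with
    | zero => rfl
    | succ k ih => exact kpair_ext (smul_zero c) ih
  have zero : ∀ k, ktop k (0 : M) = 0 := by
    intro k
    induction k with
    | zero => rfl
    | succ k ih => exact kpair_ext rfl ih
  have h2 : ∀ l ≤ k, kd a l (ktop l m) = 0 := by
    intro l
    induction l with
    | zero => intro _; rfl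
    | succ l ih =>
      intro hl
      refine kpair_ext ?_ ?_
      · simp only [kfst_kd, ktop, kfst_kpair, ksnd_kpair, map_zero, zero_add, kfst_zero]
        rw [smul, ha l hl, zero]
      · simp only [ksnd_kd, ktop, ksnd_kpair, ksnd_zero, ih (by omega), neg_zero]
  obtain ⟨w, hw, hwz⟩ := h _ (h1 k) (h2 k le_rfl)
  have hw0 : w = 0 := funext fun T => (hw T).2 (by have := kdeg_le k T; omega)
  have h3 : ∀ k, ktop k m = 0 → m = 0 := by
    intro k
    induction k with
    | zero => exact fun h => congrFun h ()
    | succ k ih => exact fun h => ih (congrArg ksnd h)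
  exact h3 k (by rw [← hwz, hw0, map_zero])

/-- The index of the basis element of exterior degree `0`. -/
def kzero : (k : ℕ) → KIdx k
  | 0 => ()
  | k + 1 => Sum.inl (kzero k)

theorem kbot_kzero (k : ℕ) (m : M) : kbot k m (kzero k) = m := by
  induction k with
  | zero => rfl
  | succ k ih => exact ih

theorem kd_kzero_mem (a : ℕ → A) (k : ℕ) (w : KIdx k → M) :
    kd a k w (kzero k) ∈ Ideal.span (a '' Set.Iio k) • (⊤ : Submodule A M) := by
  induction k with
  | zero => exact zero_mem _
  | succ k ih =>
    change kd a k (kfst w) (kzero k) + a k • ksnd w (kzero k) ∈ _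
    refine add_mem (Submodule.smul_mono_left (Ideal.span_mono (Set.image_mono ?_)) (ih _))
      (Submodule.smul_mem_smul (Ideal.subset_span ⟨k, Nat.lt_succ_self k, rfl⟩) trivial)
    exact fun i hi => Nat.lt_succ_of_lt hi

/-- The image of the Koszul differential in exterior degree `0` consists of sums `∑ a i • m i`. -/
theorem mem_span_smul_of_kd_eq_kbot {a : ℕ → A} {k : ℕ} {w : KIdx k → M} {m : M}
    (h : kd a k w = kbot k m) : m ∈ Ideal.span (a '' Set.Iio k) • (⊤ : Submodule A M) := by
  have := kd_kzero_mem a k w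
  rwa [h, kbot_kzero] at this

theorem exists_kd_eq_kbot {a : ℕ → A} {k : ℕ} {j : ℤ} {m : M}
    (h : m ∈ AddSubgroup.closure {y | ∃ i < k, ∃ x ∈ 𝓜 (j - 1), y = a i • x}) :
    ∃ w ∈ kchain 𝓜 k 1 j, kd a k w = kbot k m := by
  induction h using AddSubgroup.closure_induction with
  | mem y hy =>
    obtain ⟨i, hi, x, hx, rfl⟩ := hy
    refine ⟨kh M i k (kbot k x), ?_, ?_⟩
    · have := kh_mem i (kbot_mem (k := k) hx)
      rwa [sub_add_cancel] at this
    · have := kd_kh_add_kh_kd a i k hi (kbot k x)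
      rw [kd_of_mem_zero a (kbot_mem hx)] at this
      rw [← kbot_smul, kh_zero, add_zero] at this
      exact this
  | zero => exact ⟨0, zero_mem _, by rw [map_zero, kbot_zero]⟩
  | add x y _ _ hx hy =>
    obtain ⟨w, hw, h1⟩ := hx
    obtain ⟨w', hw', h2⟩ := hy
    exact ⟨w + w', add_mem hw hw', by rw [map_add, h1, h2, kbot_add]⟩
  | neg x _ hx =>
    obtain ⟨w, hw, h1⟩ := hx
    exact ⟨-w, neg_mem hw, by rw [map_neg, h1, kbot_neg]⟩

/-- Adding a further element preserves acyclicity of the Koszul complex in positive degrees if that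
element is a nonzerodivisor modulo the previous ones. -/
theorem KVan.succ_of_regular {a : ℕ → A} {k : ℕ}
    (ha : ∀ i j, ∀ x ∈ 𝓜 j, a i • x ∈ 𝓜 (j + 1))
    (h : ∀ p j, KVan a k 𝓜 (p + 1) j)
    (hreg : ∀ j, ∀ m ∈ 𝓜 j, a k • m ∈ Ideal.span (a '' Set.Iio k) • (⊤ : Submodule A M) →
      ∃ w ∈ kchain 𝓜 k 1 j, kd a k w = kbot k m) (p : ℕ) (j : ℤ) :
    KVan a (k + 1) 𝓜 (p + 1) j := by
  intro z hz hdz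
  have hz' := mem_kchain_succ.1 hz
  have h1 : kd a k (kfst z) + a k • ksnd z = 0 := congrArg kfst hdz
  have h2 : kd a k (ksnd z) = 0 := by
    have : -kd a k (ksnd z) = 0 := congrArg ksnd hdz
    simpa using this
  obtain ⟨b, hb, hdb⟩ : ∃ b ∈ kchain 𝓜 k (p + 1) (j - 1), kd a k b = ksnd z := by
    cases p with
    | zero =>
      obtain ⟨m, hm, hzm⟩ := exists_eq_kbot hz'.2
      rw [hzm]
      refine hreg _ m hm (mem_span_smul_of_kd_eq_kbot (w := -kfst z) (k := k) ?_)
      rw [map_neg, neg_eq_iff_add_eq_zero, kbot_smul, ← hzm, h1]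
    | succ p => exact h p (j - 1) _ hz'.2 h2
  have smulb : a k • b ∈ kchain 𝓜 k (p + 1) j := by
    intro T
    refine ⟨fun hT => ?_, fun hT => ?_⟩
    · have := ha k _ _ ((hb T).1 hT)
      rwa [show j - 1 - ((p + 1 : ℕ) : ℤ) + 1 = j - ((p + 1 : ℕ) : ℤ) by ring] at this
    · rw [Pi.smul_apply, (hb T).2 hT, smul_zero]
  obtain ⟨u, hu, hdu⟩ := h p j (kfst z + a k • b) (add_mem hz'.1 smulb) (by
    rw [map_add, map_smul, hdb, h1])
  refine ⟨kpair u (-b), mem_kchain_succ.2 ⟨hu, by simpa using neg_mem hb⟩, kpair_ext ?_ ?_⟩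
  · simp [hdu]
  · simp [hdb]

end Graded

/-! ### The long exact sequence of Koszul homology -/

section LES

variable {A : Type*} [CommRing A] {M₁ M₂ M₃ : Type*} [AddCommGroup M₁] [AddCommGroup M₂]
  [AddCommGroup M₃] [Module A M₁] [Module A M₂] [Module A M₃]

/-- A short exact sequence `0 → M₁ → M₂ → M₃ → 0` of graded modules. Exactness in the middle and on the
right is asked degree by degree, which is what lifting homogeneous Koszul chains needs. -/
structure GradedShortExact (𝓜₁ : ℤ → AddSubgroup M₁) (𝓜₂ : ℤ → AddSubgroup M₂)
    (𝓜₃ : ℤ → AddSubgroup M₃) (f : M₁ →ₗ[A] M₂) (g : M₂ →ₗ[A] M₃) : Prop where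
  map_f : ∀ j, ∀ x ∈ 𝓜₁ j, f x ∈ 𝓜₂ j
  map_g : ∀ j, ∀ x ∈ 𝓜₂ j, g x ∈ 𝓜₃ j
  comp : ∀ x, g (f x) = 0
  inj : ∀ x, f x = 0 → x = 0
  exact : ∀ j, ∀ x ∈ 𝓜₂ j, g x = 0 → ∃ y ∈ 𝓜₁ j, f y = x
  surj : ∀ j, ∀ x ∈ 𝓜₃ j, ∃ y ∈ 𝓜₂ j, g y = x

theorem kchain_map {𝓜₁ : ℤ → AddSubgroup M₁} {𝓜₂ : ℤ → AddSubgroup M₂} {f : M₁ →ₗ[A] M₂}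
    (hf : ∀ j, ∀ x ∈ 𝓜₁ j, f x ∈ 𝓜₂ j) {k p : ℕ} {j : ℤ} {z : KIdx k → M₁}
    (hz : z ∈ kchain 𝓜₁ k p j) : (fun T => f (z T)) ∈ kchain 𝓜₂ k p j := fun T =>
  ⟨fun hT => hf _ _ ((hz T).1 hT), fun hT => (congrArg f ((hz T).2 hT)).trans (map_zero f)⟩

theorem kchain_lift {𝓜₁ : ℤ → AddSubgroup M₁} {𝓜₂ : ℤ → AddSubgroup M₂} {f : M₁ →ₗ[A] M₂}
    {k p : ℕ} {j : ℤ} {z : KIdx k → M₂} (hz : z ∈ kchain 𝓜₂ k p j)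
    (h : ∀ T, z T ∈ 𝓜₂ (j - p) → ∃ y ∈ 𝓜₁ (j - p), f y = z T) :
    ∃ w ∈ kchain 𝓜₁ k p j, (fun T => f (w T)) = z := by
  have : ∀ T, ∃ y, ((kdeg k T = p → y ∈ 𝓜₁ (j - p)) ∧ (kdeg k T ≠ p → y = 0)) ∧ f y = z T := by
    intro T
    by_cases hT : kdeg k T = p
    · obtain ⟨y, hy, hyz⟩ := h T ((hz T).1 hT)
      exact ⟨y, ⟨fun _ => hy, fun h => absurd hT h⟩, hyz⟩
    · exact ⟨0, ⟨fun _ => zero_mem _, fun _ => rfl⟩, by rw [map_zero, (hz T).2 hT]⟩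
  choose w hw hwz using this
  exact ⟨w, hw, funext hwz⟩

theorem kd_map (a : ℕ → A) (f : M₁ →ₗ[A] M₂) (k : ℕ) (z : KIdx k → M₁) :
    kd a k (fun T => f (z T)) = fun T => f (kd a k z T) :=
  kd_comp a a f.toAddMonoidHom (fun i x => map_smul f (a i) x) k z

namespace GradedShortExact

variable {𝓜₁ : ℤ → AddSubgroup M₁} {𝓜₂ : ℤ → AddSubgroup M₂} {𝓜₃ : ℤ → AddSubgroup M₃}
  {f : M₁ →ₗ[A] M₂} {g : M₂ →ₗ[A] M₃} {a : ℕ → A} {k : ℕ}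

theorem kvan_right_zero (S : GradedShortExact 𝓜₁ 𝓜₂ 𝓜₃ f g) {j : ℤ}
    (h₂ : KVan a k 𝓜₂ 0 j) : KVan a k 𝓜₃ 0 j := by
  intro z hz _
  obtain ⟨b, hb, rfl⟩ := kchain_lift hz (fun T hT => S.surj _ _ hT)
  obtain ⟨w, hw, hwb⟩ := h₂ b hb (kd_of_mem_zero a hb)
  exact ⟨_, kchain_map S.map_g hw, by rw [kd_map, hwb]⟩

theorem kvan_right (S : GradedShortExact 𝓜₁ 𝓜₂ 𝓜₃ f g)
    (ha : ∀ i j, ∀ x ∈ 𝓜₂ j, a i • x ∈ 𝓜₂ (j + 1)) {p : ℕ} {j : ℤ}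
    (h₂ : KVan a k 𝓜₂ (p + 1) j) (h₁ : KVan a k 𝓜₁ p j) : KVan a k 𝓜₃ (p + 1) j := by
  intro z hz hdz
  obtain ⟨b, hb, rfl⟩ := kchain_lift hz (fun T hT => S.surj _ _ hT)
  rw [kd_map] at hdz
  obtain ⟨u, hu, hub⟩ := kchain_lift (kd_mem a ha hb) (fun T hT =>
    S.exact _ _ hT (congrFun hdz T))
  have hdu : kd a k u = 0 := by
    have h1 := kd_map a f k u
    rw [hub, kd_kd] at h1
    exact funext fun T => S.inj _ (congrFun h1 T).symm
  obtain ⟨v, hv, hvu⟩ := h₁ u hu hdu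
  obtain ⟨w, hw, hwb⟩ := h₂ (b - fun T => f (v T)) (sub_mem hb (kchain_map S.map_f hv)) (by
    rw [map_sub, kd_map, hvu, hub, sub_self])
  refine ⟨_, kchain_map S.map_g hw, ?_⟩
  rw [kd_map, hwb]
  funext T
  simp [S.comp]

/-- Koszul homology of `M₁` vanishes if that of `M₃` one degree higher does and the map to the
Koszul homology of `M₂` is zero. -/
theorem kvan_left (S : GradedShortExact 𝓜₁ 𝓜₂ 𝓜₃ f g)
    (ha : ∀ i j, ∀ x ∈ 𝓜₂ j, a i • x ∈ 𝓜₂ (j + 1)) {p : ℕ} {j : ℤ}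
    (h₂ : ∀ z ∈ kchain 𝓜₁ k p j, kd a k z = 0 →
      ∃ w ∈ kchain 𝓜₂ k (p + 1) j, kd a k w = fun T => f (z T))
    (h₃ : KVan a k 𝓜₃ (p + 1) j) : KVan a k 𝓜₁ p j := by
  intro z hz hdz
  obtain ⟨b, hb, hbz⟩ := h₂ z hz hdz
  obtain ⟨w, hw, hwb⟩ := h₃ _ (kchain_map S.map_g hb) (by
    rw [kd_map, hbz]; funext T; exact S.comp _)
  obtain ⟨e, he, rfl⟩ := kchain_lift hw (fun T hT => S.surj _ _ hT)
  rw [kd_map] at hwb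
  obtain ⟨u, hu, hub⟩ := kchain_lift (f := f) (sub_mem hb (kd_mem a ha he)) (fun T hT =>
    S.exact _ _ hT (by
      have : g (kd a k e T) = g (b T) := congrFun hwb T
      simp [this]))
  refine ⟨u, hu, ?_⟩
  have h1 := kd_map a f k u
  rw [hub, map_sub, kd_kd, hbz, sub_zero] at h1
  funext T
  rw [← sub_eq_zero]
  refine S.inj _ ?_
  rw [map_sub, ← congrFun h1 T, sub_self]

end GradedShortExact

end LES

/-! ### Regularity through Koszul homology -/

/-- The variables of the polynomial ring, indexed by all natural numbers and continued by zero. -/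
def xvar (F : Type*) [Field F] (r : ℕ) (i : ℕ) : PolyRing F r :=
  if h : i < r + 1 then MvPolynomial.X ⟨i, h⟩ else 0

section

variable {F : Type*} [Field F] {r : ℕ}

theorem xvar_of_lt {i : ℕ} (h : i < r + 1) : xvar F r i = MvPolynomial.X ⟨i, h⟩ := dif_pos h

theorem xvar_fin (i : Fin (r + 1)) : xvar F r i = MvPolynomial.X i := xvar_of_lt i.2

theorem isHomogeneous_xvar (i : ℕ) : (xvar F r i).IsHomogeneous 1 := by
  unfold xvar
  split_ifs
  · exact MvPolynomial.isHomogeneous_X _ _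
  · exact MvPolynomial.isHomogeneous_zero _ _ _

theorem image_xvar {k : ℕ} (hk : k ≤ r + 1) :
    xvar F r '' Set.Iio k = MvPolynomial.X '' {i : Fin (r + 1) | (i : ℕ) < k} := by
  ext p
  constructor
  · rintro ⟨i, hi, rfl⟩
    exact ⟨⟨i, lt_of_lt_of_le hi hk⟩, hi, (xvar_of_lt _).symm⟩
  · rintro ⟨i, hi, rfl⟩
    exact ⟨i, hi, xvar_fin i⟩

theorem irrelevantIdeal_eq_span : irrelevantIdeal F r = Ideal.span (xvar F r '' Set.Iio (r + 1)) := by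
  rw [image_xvar le_rfl, irrelevantIdeal]
  rw [← Set.image_univ]
  congr 2
  exact (Set.eq_univ_of_forall fun i => i.2).symm

theorem mem_irrelevantIdeal_iff {p : PolyRing F r} : p ∈ irrelevantIdeal F r ↔ p.coeff 0 = 0 := by
  rw [irrelevantIdeal, ← Set.image_univ, MvPolynomial.mem_ideal_span_X_image]
  constructor
  · intro h
    by_contra h0
    obtain ⟨i, _, hi⟩ := h 0 (MvPolynomial.mem_support_iff.2 h0)
    exact hi rfl
  · intro h α hα
    by_contra hcon
    push Not at hcon
    have : α = 0 := Finsupp.ext fun i => hcon i trivial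
    exact MvPolynomial.mem_support_iff.1 hα (this ▸ h)

theorem mem_smul_top_pi {n : ℕ} {J : Ideal (PolyRing F r)} {v : Fin n → PolyRing F r} :
    v ∈ J • (⊤ : Submodule (PolyRing F r) (Fin n → PolyRing F r)) ↔ ∀ l, v l ∈ J := by
  constructor
  · intro hv l
    refine Submodule.smul_induction_on hv (fun p hp w _ => J.mul_mem_right _ hp) fun x y hx hy =>
      J.add_mem hx hy
  · intro h
    have : v = ∑ l, v l • Pi.single l (1 : PolyRing F r) := by
      conv_lhs => rw [← Finset.univ_sum_single v]
      refine Finset.sum_congr rfl fun l _ => ?_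
      rw [← Pi.single_smul, smul_eq_mul, mul_one]
    rw [this]
    exact sum_mem fun l _ => Submodule.smul_mem_smul (h l) trivial

section Modules

variable {M : Type*} [AddCommGroup M] [Module (PolyRing F r) M] {𝓜 : ℤ → AddSubgroup M}

variable (F r) in
/-- `M` is `c`-regular in the sense of Koszul homology with respect to the variables: there is none
of exterior degree `p` and total degree larger than `c + p`. -/
def Kreg (𝓜 : ℤ → AddSubgroup M) (c : ℤ) : Prop :=
  ∀ (p : ℕ) (j : ℤ), c + p < j → KVan (xvar F r) (r + 1) 𝓜 p j

theorem Kreg.of_forall_eq_zero {c : ℤ} (h : ∀ j, c < j → ∀ x ∈ 𝓜 j, x = 0) : Kreg F r 𝓜 c :=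
  fun p j hj => KVan.of_forall_eq_zero _ _ _ (h _ (by omega))

theorem Kreg.mono {c c' : ℤ} (h : Kreg F r 𝓜 c) (hc : c ≤ c') : Kreg F r 𝓜 c' :=
  fun p j hj => h p j (by omega)

variable (h : IsGrading (F := F) (r := r) 𝓜)
include h

theorem IsGrading.xvar_smul_mem (i : ℕ) (j : ℤ) (x : M) (hx : x ∈ 𝓜 j) :
    xvar F r i • x ∈ 𝓜 (j + 1) := by
  have := h.smul_mem 1 j _ x (isHomogeneous_xvar i) hx
  rwa [Nat.cast_one, add_comm] at this

theorem IsGrading.exists_kd_eq_kbot {k : ℕ} {j : ℤ} {m : M} (hm : m ∈ 𝓜 j)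
    (hm' : m ∈ Ideal.span (xvar F r '' Set.Iio k) • (⊤ : Submodule (PolyRing F r) M)) :
    ∃ w ∈ kchain 𝓜 k 1 j, kd (xvar F r) k w = kbot k m := by
  refine GradedReg.exists_kd_eq_kbot ?_
  have := h.mem_closure_of_mem_span_smul (d := 1) (s := xvar F r '' Set.Iio k) (by
    rintro _ ⟨i, _, rfl⟩
    exact isHomogeneous_xvar i) hm' hm
  refine AddSubgroup.closure_mono ?_ this
  rintro _ ⟨_, ⟨i, hi, rfl⟩, x, hx, rfl⟩
  exact ⟨i, hi, x, by simpa using hx, rfl⟩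

end Modules

/-- The Koszul complex of the variables on a free module is acyclic in positive degrees. -/
theorem kvan_freeGrading {n : ℕ} (deg : Fin n → ℤ) (p : ℕ) (j : ℤ) :
    KVan (xvar F r) (r + 1) (freeGrading F r deg) (p + 1) j := by
  have hG := isGrading_freeGrading (F := F) (r := r) deg
  suffices H : ∀ k ≤ r + 1, ∀ p j, KVan (xvar F r) k (freeGrading F r deg) (p + 1) j from
    H _ le_rfl p j
  intro k
  induction k with
  | zero =>
    intro _ p j z hz _
    refine ⟨0, zero_mem _, ?_⟩
    rw [map_zero]
    exact funext fun T => ((hz T).2 (Nat.succ_ne_zero p).symm).symm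
  | succ k ih =>
    intro hk
    refine KVan.succ_of_regular hG.xvar_smul_mem (ih (by omega)) fun j m hm hkm => ?_
    refine hG.exists_kd_eq_kbot hm ?_
    rw [mem_smul_top_pi] at hkm ⊢
    intro l
    have h1 := hkm l
    rw [image_xvar (by omega), MvPolynomial.mem_ideal_span_X_image] at h1 ⊢
    intro α hα
    rw [xvar_of_lt hk, Pi.smul_apply, smul_eq_mul] at h1
    obtain ⟨i, hi, hi'⟩ := h1 (Finsupp.single ⟨k, hk⟩ 1 + α) (by
      rw [MvPolynomial.mem_support_iff, MvPolynomial.coeff_X_mul]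
      exact MvPolynomial.mem_support_iff.1 hα)
    refine ⟨i, hi, fun h0 => hi' ?_⟩
    have : (⟨k, hk⟩ : Fin (r + 1)) ≠ i := by
      rintro rfl
      exact lt_irrefl k hi
    simp [h0, Finsupp.single_eq_of_ne' this]

theorem kvan_freeGrading_zero {n : ℕ} (deg : Fin n → ℤ) {j : ℤ} (hj : ∀ l, deg l < j) :
    KVan (xvar F r) (r + 1) (freeGrading F r deg) 0 j := by
  intro z hz _
  obtain ⟨m, hm, rfl⟩ := exists_eq_kbot hz
  refine (isGrading_freeGrading deg).exists_kd_eq_kbot hm ?_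
  rw [← irrelevantIdeal_eq_span, mem_smul_top_pi]
  intro l
  rw [mem_irrelevantIdeal_iff]
  by_contra h0
  have := isForm_iff.1 (hm l) 0 h0
  have := hj l
  simp at *
  omega

section Modules

variable {M : Type*} [AddCommGroup M] [Module (PolyRing F r) M] {𝓜 : ℤ → AddSubgroup M}

/-- In a minimal free cover, no generator has a degree in which `M = 𝔪 M`. -/
theorem not_kvan_of_minimal {n : ℕ} {deg : Fin n → ℤ} {g : (Fin n → PolyRing F r) →ₗ[PolyRing F r] M}
    (hg : Function.Surjective g)
    (hmin : LinearMap.ker g ≤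
      irrelevantIdeal F r • (⊤ : Submodule (PolyRing F r) (Fin n → PolyRing F r)))
    (hdeg : ∀ l, g (Pi.single l 1) ∈ 𝓜 (deg l)) (l : Fin n) :
    ¬ KVan (xvar F r) (r + 1) 𝓜 0 (deg l) := by
  intro h
  obtain ⟨w, _, hw⟩ := h _ (kbot_mem (hdeg l)) (kd_of_mem_zero _ (kbot_mem (hdeg l)))
  have h1 := mem_span_smul_of_kd_eq_kbot hw
  rw [← irrelevantIdeal_eq_span, ← LinearMap.range_eq_top.2 hg, ← Submodule.map_top,
    ← Submodule.map_smul''] at h1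
  obtain ⟨u, hu, hug⟩ := h1
  have h2 : Pi.single l 1 - u ∈ LinearMap.ker g := by
    rw [LinearMap.mem_ker, map_sub, hug, sub_self]
  have h3 := add_mem (hmin h2) hu
  rw [sub_add_cancel, mem_smul_top_pi] at h3
  have h4 := h3 l
  rw [Pi.single_eq_same, mem_irrelevantIdeal_iff] at h4
  simp at h4

theorem map_mem_of_basis (h : IsGrading (F := F) (r := r) 𝓜) {n : ℕ} {deg : Fin n → ℤ}
    {g : (Fin n → PolyRing F r) →ₗ[PolyRing F r] M}
    (hdeg : ∀ l, g (Pi.single l 1) ∈ 𝓜 (deg l)) (j : ℤ) (v : Fin n → PolyRing F r)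
    (hv : v ∈ freeGrading F r deg j) : g v ∈ 𝓜 j := by
  have : v = ∑ l, v l • Pi.single l (1 : PolyRing F r) := by
    conv_lhs => rw [← Finset.univ_sum_single v]
    refine Finset.sum_congr rfl fun l _ => ?_
    rw [← Pi.single_smul, smul_eq_mul, mul_one]
  rw [this, map_sum]
  refine sum_mem fun l _ => ?_
  rw [map_smul]
  rcases hv l with h0 | ⟨a, ha, h1⟩
  · rw [h0, zero_smul]
    exact zero_mem _
  · have := h.smul_mem a _ _ _ h1 (hdeg l)
    rwa [ha, sub_add_cancel] at this

/-- The short exact sequence given by a graded free cover. -/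
theorem gradedShortExact_of_cover (h : IsGrading (F := F) (r := r) 𝓜) {n : ℕ} {deg : Fin n → ℤ}
    {g : (Fin n → PolyRing F r) →ₗ[PolyRing F r] M} (hg : Function.Surjective g)
    (hdeg : ∀ l, g (Pi.single l 1) ∈ 𝓜 (deg l))
    {N : Submodule (PolyRing F r) (Fin n → PolyRing F r)} (hN : LinearMap.ker g = N) :
    GradedShortExact (fun j => (freeGrading F r deg j).comap N.subtype.toAddMonoidHom)
      (freeGrading F r deg) 𝓜 N.subtype g where
  map_f _ _ hx := hx
  map_g := map_mem_of_basis h hdeg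
  comp x := hN.ge x.2
  inj x hx := Subtype.ext hx
  exact j x hx hgx := ⟨⟨x, by rw [← hN]; exact hgx⟩, hx, rfl⟩
  surj j x hx := by
    obtain ⟨y, rfl⟩ := hg x
    refine ⟨_, (isGrading_freeGrading deg).proj_mem j y, ?_⟩
    have := (isGrading_freeGrading deg).proj_map h g.toAddMonoidHom (map_mem_of_basis h hdeg) j y
    change h.proj j (g y) = _ at this
    rw [h.proj_of_mem hx] at this
    exact this.symm

theorem homogeneous_ker (h : IsGrading (F := F) (r := r) 𝓜) {n : ℕ} {deg : Fin n → ℤ}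
    {g : (Fin n → PolyRing F r) →ₗ[PolyRing F r] M}
    (hdeg : ∀ l, g (Pi.single l 1) ∈ 𝓜 (deg l)) :
    ∀ x ∈ LinearMap.ker g, ∀ j, (isGrading_freeGrading deg).proj j x ∈ LinearMap.ker g := by
  intro x hx j
  have := (isGrading_freeGrading deg).proj_map h g.toAddMonoidHom (map_mem_of_basis h hdeg) j x
  change h.proj j (g x) = g _ at this
  rw [LinearMap.mem_ker, ← this, LinearMap.mem_ker.1 hx, map_zero]

namespace MinimalGradedFreeResolution

variable (R : MinimalGradedFreeResolution (F := F) (r := r) 𝓜)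

/-- The grading of the syzygy module `im (F_{i+1} → F_i)`. -/
def syzGrading (i : ℕ) : ℤ → AddSubgroup (LinearMap.range (R.d i)) := fun j =>
  (freeGrading F r (R.deg i) j).comap (LinearMap.range (R.d i)).subtype.toAddMonoidHom

theorem ker_eq_range_zero : LinearMap.ker R.ε = LinearMap.range (R.d 0) :=
  LinearMap.exact_iff.1 R.exact_ε

theorem ker_eq_range_succ (i : ℕ) :
    LinearMap.ker (R.d i).rangeRestrict = LinearMap.range (R.d (i + 1)) := by
  rw [LinearMap.ker_rangeRestrict]
  exact LinearMap.exact_iff.1 (R.exact_d i)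

theorem rangeRestrict_single_mem (i : ℕ) (l : Fin (R.rank (i + 1))) :
    (R.d i).rangeRestrict (Pi.single l 1) ∈ R.syzGrading i (R.deg (i + 1) l) :=
  fun k => R.d_graded i l k

theorem isGrading_syzGrading (h : IsGrading (F := F) (r := r) 𝓜) (i : ℕ) :
    IsGrading (F := F) (r := r) (R.syzGrading i) := by
  induction i with
  | zero =>
    refine (isGrading_freeGrading (R.deg 0)).submodule ?_
    rw [← ker_eq_range_zero]
    exact homogeneous_ker h R.ε_graded
  | succ i ih =>
    refine (isGrading_freeGrading (R.deg (i + 1))).submodule ?_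
    rw [← ker_eq_range_succ]
    exact homogeneous_ker ih (R.rangeRestrict_single_mem i)

theorem shortExact_zero (h : IsGrading (F := F) (r := r) 𝓜) :
    GradedShortExact (R.syzGrading 0) (freeGrading F r (R.deg 0)) 𝓜
      (LinearMap.range (R.d 0)).subtype R.ε :=
  gradedShortExact_of_cover h R.surjective_ε R.ε_graded R.ker_eq_range_zero

theorem shortExact_succ (h : IsGrading (F := F) (r := r) 𝓜) (i : ℕ) :
    GradedShortExact (R.syzGrading (i + 1)) (freeGrading F r (R.deg (i + 1))) (R.syzGrading i)
      (LinearMap.range (R.d (i + 1))).subtype (R.d i).rangeRestrict :=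
  gradedShortExact_of_cover (R.isGrading_syzGrading h i) (R.d i).surjective_rangeRestrict
    (R.rangeRestrict_single_mem i) (R.ker_eq_range_succ i)

/-- The degrees in a resolution bound the degrees in which there is Koszul homology, by dimension
shifting along the syzygies. -/
theorem kreg (h : IsGrading (F := F) (r := r) 𝓜) {c : ℤ}
    (hc : ∀ i (l : Fin (R.rank i)), R.deg i l ≤ c + i) : Kreg F r 𝓜 c := by
  have H : ∀ (p i : ℕ) (j : ℤ), c + i + 1 + p < j →
      KVan (xvar F r) (r + 1) (R.syzGrading i) p j := by
    intro p
    induction p with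
    | zero =>
      intro i j hj
      refine (R.shortExact_succ h i).kvan_right_zero (kvan_freeGrading_zero _ fun l => ?_)
      have := hc (i + 1) l
      push_cast at *
      omega
    | succ p ih =>
      intro i j hj
      refine (R.shortExact_succ h i).kvan_right (isGrading_freeGrading _).xvar_smul_mem
        (kvan_freeGrading _ _ _) (ih _ _ ?_)
      push_cast at *
      omega
  intro p j hj
  cases p with
  | zero =>
    refine (R.shortExact_zero h).kvan_right_zero (kvan_freeGrading_zero _ fun l => ?_)
    have := hc 0 l
    push_cast at *
    omega
  | succ p =>
    refine (R.shortExact_zero h).kvan_right (isGrading_freeGrading _).xvar_smul_mem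
        (kvan_freeGrading _ _ _) (H _ _ _ ?_)
    push_cast at *
    omega

/-- Minimality: the Koszul homology of a syzygy module maps to zero in that of the free module. -/
theorem exists_kd_eq_syz (i p : ℕ) (j : ℤ) (z : KIdx (r + 1) → LinearMap.range (R.d i))
    (hz : z ∈ kchain (R.syzGrading i) (r + 1) p j) (hdz : kd (xvar F r) (r + 1) z = 0) :
    ∃ w ∈ kchain (freeGrading F r (R.deg i)) (r + 1) (p + 1) j,
      kd (xvar F r) (r + 1) w = fun T => (LinearMap.range (R.d i)).subtype (z T) := by
  have hz' := kchain_map (𝓜₂ := freeGrading F r (R.deg i))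
    (f := (LinearMap.range (R.d i)).subtype) (fun _ _ hx => hx) hz
  cases p with
  | zero =>
    obtain ⟨m, hm, rfl⟩ := exists_eq_kbot hz
    have := kbot_map (LinearMap.range (R.d i)).subtype.toAddMonoidHom (r + 1) m
    change (fun T => (LinearMap.range (R.d i)).subtype (kbot (r + 1) m T)) = _ at this
    rw [this]
    refine (isGrading_freeGrading (R.deg i)).exists_kd_eq_kbot hm ?_
    rw [← irrelevantIdeal_eq_span]
    exact R.minimal i m.2
  | succ p =>
    refine kvan_freeGrading _ _ _ _ hz' ?_
    rw [kd_map, hdz]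
    rfl

theorem deg_le (h : IsGrading (F := F) (r := r) 𝓜) {c : ℤ} (hc : Kreg F r 𝓜 c) (i : ℕ)
    (l : Fin (R.rank i)) : R.deg i l ≤ c + i := by
  have H : ∀ (i p : ℕ) (j : ℤ), c + i + 1 + p < j →
      KVan (xvar F r) (r + 1) (R.syzGrading i) p j := by
    intro i
    induction i with
    | zero =>
      intro p j hj
      refine (R.shortExact_zero h).kvan_left (isGrading_freeGrading _).xvar_smul_mem
        (R.exists_kd_eq_syz 0 p j) (hc _ _ ?_)
      push_cast at *
      omega
    | succ i ih =>
      intro p j hj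
      refine (R.shortExact_succ h i).kvan_left (isGrading_freeGrading _).xvar_smul_mem
        (R.exists_kd_eq_syz (i + 1) p j) (ih _ _ ?_)
      push_cast at *
      omega
  by_contra hcon
  cases i with
  | zero =>
    refine not_kvan_of_minimal R.surjective_ε ?_ R.ε_graded l (hc _ _ ?_)
    · rw [R.ker_eq_range_zero]
      exact R.minimal 0
    · push_cast at *
      omega
  | succ i =>
    refine not_kvan_of_minimal (R.d i).surjective_rangeRestrict ?_ (R.rangeRestrict_single_mem i) l
      (H _ _ _ ?_)
    · rw [R.ker_eq_range_succ]
      exact R.minimal (i + 1)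
    · push_cast at *
      omega

end MinimalGradedFreeResolution

end Modules

end

/-! ### Existence of minimal graded free resolutions -/

section

variable {F : Type*} [Field F] {r : ℕ}

section Modules

variable {M : Type*} [AddCommGroup M] [Module (PolyRing F r) M] {𝓜 : ℤ → AddSubgroup M}

theorem IsGrading.exists_proj_smul_eq (h : IsGrading (F := F) (r := r) 𝓜) {i : ℤ} {x : M}
    (hx : x ∈ 𝓜 i) (j : ℤ) (p : PolyRing F r) :
    ∃ q : PolyRing F r, h.proj j (p • x) = q • x ∧ (j = i → q = MvPolynomial.C (p.coeff 0)) := by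
  induction p using MvPolynomial.induction_on' with
  | monomial u c =>
    have hu : (MvPolynomial.monomial u c : PolyRing F r).IsHomogeneous u.degree :=
      MvPolynomial.isHomogeneous_monomial _ rfl
    have h1 := h.smul_mem _ _ _ x hu hx
    by_cases hj : (u.degree : ℤ) + i = j
    · subst hj
      refine ⟨_, h.proj_of_mem h1, fun hj => ?_⟩
      have : u = 0 := by
        rw [← Finsupp.degree_eq_zero_iff]
        omega
      subst this
      rw [MvPolynomial.coeff_monomial, if_pos rfl, MvPolynomial.C_apply]
    · refine ⟨0, by rw [h.proj_of_mem_ne h1 hj, zero_smul], fun hji => ?_⟩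
      have : u ≠ 0 := by
        rintro rfl
        simp at hj
        exact hj hji.symm
      simp [MvPolynomial.coeff_monomial, this]
  | add p p' hp hp' =>
    obtain ⟨q, h1, h2⟩ := hp
    obtain ⟨q', h1', h2'⟩ := hp'
    refine ⟨q + q', by rw [add_smul, map_add, h1, h1', add_smul], fun hj => ?_⟩
    rw [h2 hj, h2' hj, MvPolynomial.coeff_add, map_add]

theorem IsGrading.exists_finset_span (h : IsGrading (F := F) (r := r) 𝓜)
    [hfin : Module.Finite (PolyRing F r) M] :
    ∃ T : Finset M, (∀ x ∈ T, ∃ j, x ∈ 𝓜 j) ∧ Submodule.span (PolyRing F r) (T : Set M) = ⊤ := by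
  classical
  obtain ⟨T, hT⟩ := hfin.fg_top
  choose s hs using h.exists_sum_proj
  refine ⟨T.biUnion fun x => (s x).image fun j => h.proj j x, ?_, ?_⟩
  · intro y hy
    simp only [Finset.mem_biUnion, Finset.mem_image] at hy
    obtain ⟨x, _, j, _, rfl⟩ := hy
    exact ⟨j, h.proj_mem j x⟩
  · rw [eq_top_iff, ← hT, Submodule.span_le]
    intro x hx
    rw [hs x]
    refine sum_mem fun j hj => Submodule.subset_span ?_
    simp only [Finset.coe_biUnion, Finset.coe_image, Set.mem_iUnion, Set.mem_image]
    exact ⟨x, hx, j, hj, rfl⟩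

/-- A homogeneous generating set with the least number of elements yields a minimal free cover: a
relation with a unit coefficient would allow to drop a generator. -/
theorem IsGrading.exists_minimal_cover (h : IsGrading (F := F) (r := r) 𝓜)
    [Module.Finite (PolyRing F r) M] :
    ∃ (n : ℕ) (deg : Fin n → ℤ) (g : (Fin n → PolyRing F r) →ₗ[PolyRing F r] M),
      Function.Surjective g ∧ LinearMap.ker g ≤
        irrelevantIdeal F r • (⊤ : Submodule (PolyRing F r) (Fin n → PolyRing F r)) ∧
      ∀ l, g (Pi.single l 1) ∈ 𝓜 (deg l) := by
  classical
  have hex : ∃ n, ∃ T : Finset M, T.card = n ∧ (∀ x ∈ T, ∃ j, x ∈ 𝓜 j) ∧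
      Submodule.span (PolyRing F r) (T : Set M) = ⊤ := by
    obtain ⟨T, h1, h2⟩ := h.exists_finset_span
    exact ⟨_, T, rfl, h1, h2⟩
  obtain ⟨T, hTn, hT, hspan⟩ := Nat.find_spec hex
  have hmin := fun m (hm : m < Nat.find hex) => Nat.find_min hex hm
  rw [← hTn] at hmin
  let e := T.equivFin.symm
  have hdeg : ∀ l, ∃ j, (e l : M) ∈ 𝓜 j := fun l => hT _ (e l).2
  choose deg hdeg using hdeg
  have hg1 : ∀ l, Fintype.linearCombination (PolyRing F r) (fun l => (e l : M)) (Pi.single l 1)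
      = e l := fun l => by
    rw [Fintype.linearCombination_apply_single, one_smul]
  refine ⟨T.card, deg, Fintype.linearCombination (PolyRing F r) fun l => (e l : M), ?_, ?_, ?_⟩
  · rw [← LinearMap.range_eq_top, Fintype.range_linearCombination, ← hspan]
    congr 1
    ext x
    constructor
    · rintro ⟨l, rfl⟩
      exact (e l).2
    · intro hx
      exact ⟨T.equivFin ⟨x, hx⟩, by simp [e]⟩
  · intro u hu
    rw [mem_smul_top_pi]
    by_contra hcon
    push Not at hcon
    obtain ⟨l, hl⟩ := hcon
    rw [mem_irrelevantIdeal_iff] at hl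
    rw [LinearMap.mem_ker, Fintype.linearCombination_apply] at hu
    choose q hq hq' using fun k => h.exists_proj_smul_eq (hdeg k) (deg l) (u k)
    have h1 := congrArg (h.proj (deg l)) hu
    rw [map_sum, map_zero] at h1
    simp only [hq] at h1
    rw [← Finset.add_sum_erase _ _ (Finset.mem_univ l), hq' l rfl] at h1
    have h2 : (e l : M) ∈ Submodule.span (PolyRing F r) (T.erase (e l) : Set M) := by
      have h3 : (e l : M) = (MvPolynomial.C ((u l).coeff 0)⁻¹ : PolyRing F r) •
          -∑ k ∈ Finset.univ.erase l, q k • (e k : M) := by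
        rw [← eq_neg_iff_add_eq_zero.2 h1, smul_smul, ← map_mul, inv_mul_cancel₀ hl, map_one,
          one_smul]
      have h4 : (MvPolynomial.C ((u l).coeff 0)⁻¹ : PolyRing F r) •
          -∑ k ∈ Finset.univ.erase l, q k • (e k : M) ∈
          Submodule.span (PolyRing F r) (T.erase (e l) : Set M) := by
        refine Submodule.smul_mem _ _ (neg_mem (sum_mem fun k hk =>
          Submodule.smul_mem _ _ (Submodule.subset_span ?_)))
        rw [Finset.mem_coe, Finset.mem_erase]
        exact ⟨fun hkl => (Finset.mem_erase.1 hk).1 (e.injective (Subtype.ext hkl)), (e k).2⟩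
      rwa [← h3] at h4
    refine hmin _ (Finset.card_erase_lt_of_mem (e l).2)
      ⟨T.erase (e l), rfl, fun x hx => hT x (Finset.mem_of_mem_erase hx), ?_⟩
    rw [eq_top_iff, ← hspan, Submodule.span_le]
    intro x hx
    by_cases hxl : x = e l
    · rw [hxl]
      exact h2
    · exact Submodule.subset_span (Finset.mem_erase.2 ⟨hxl, hx⟩)
  · intro l
    rw [hg1]
    exact hdeg l

end Modules

variable (F r) in
/-- A homogeneous submodule of a graded free module of finite rank. -/
structure GradedSyzygy where
  rank : ℕ
  deg : Fin rank → ℤ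
  N : Submodule (PolyRing F r) (Fin rank → PolyRing F r)
  homogeneous : ∀ x ∈ N, ∀ j, (isGrading_freeGrading deg).proj j x ∈ N

theorem GradedSyzygy.exists_next (s : GradedSyzygy F r) :
    ∃ (s' : GradedSyzygy F r)
      (φ : (Fin s'.rank → PolyRing F r) →ₗ[PolyRing F r] (Fin s.rank → PolyRing F r)),
      LinearMap.range φ = s.N ∧ LinearMap.ker φ = s'.N ∧
      s'.N ≤ irrelevantIdeal F r • (⊤ : Submodule (PolyRing F r) (Fin s'.rank → PolyRing F r)) ∧
      ∀ k l, IsForm (φ (Pi.single k 1) l) (s'.deg k - s.deg l) := by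
  have hN := (isGrading_freeGrading s.deg).submodule s.homogeneous
  have : Module.Finite (PolyRing F r) s.N := Module.IsNoetherian.finite _ _
  obtain ⟨n, deg, g, hg, hker, hdeg⟩ := hN.exists_minimal_cover
  refine ⟨⟨n, deg, LinearMap.ker g, homogeneous_ker hN hdeg⟩, s.N.subtype ∘ₗ g, ?_, ?_, hker, ?_⟩
  · rw [LinearMap.range_comp, LinearMap.range_eq_top.2 hg, Submodule.map_top, Submodule.range_subtype]
  · rw [LinearMap.ker_comp, Submodule.ker_subtype]
    rfl
  · exact fun k l => hdeg k l

theorem IsGrading.nonempty_minimalGradedFreeResolution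
    {M : Type*} [AddCommGroup M] [Module (PolyRing F r) M] {𝓜 : ℤ → AddSubgroup M}
    (h : IsGrading (F := F) (r := r) 𝓜) [Module.Finite (PolyRing F r) M] :
    Nonempty (MinimalGradedFreeResolution (F := F) (r := r) 𝓜) := by
  obtain ⟨n, deg, g, hg, hker, hdeg⟩ := h.exists_minimal_cover
  choose next φ hrange hker' hmin hφ using GradedSyzygy.exists_next (F := F) (r := r)
  let seq : ℕ → GradedSyzygy F r := fun i =>
    Nat.rec ⟨n, deg, LinearMap.ker g, homogeneous_ker h hdeg⟩ (fun _ s => next s) i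
  exact ⟨{
    rank := fun i => (seq i).rank
    deg := fun i => (seq i).deg
    d := fun i => φ (seq i)
    ε := g
    d_graded := fun i k l => hφ (seq i) k l
    ε_graded := hdeg
    exact_d := fun i => LinearMap.exact_iff.2 ((hker' (seq i)).trans (hrange (seq (i + 1))).symm)
    exact_ε := LinearMap.exact_iff.2 (hrange (seq 0)).symm
    surjective_ε := hg
    minimal := fun i => by
      rw [hrange (seq i)]
      cases i with
      | zero => exact hker
      | succ i => exact hmin (seq i) }⟩

/-- Regularity is compared through Koszul homology. -/
theorem regularity_le_add {M N : Type*} [AddCommGroup M] [Module (PolyRing F r) M]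
    [AddCommGroup N] [Module (PolyRing F r) N] [Module.Finite (PolyRing F r) N]
    {𝓜 : ℤ → AddSubgroup M} {𝓝 : ℤ → AddSubgroup N}
    (hM : IsGrading (F := F) (r := r) 𝓜) (hN : IsGrading (F := F) (r := r) 𝓝) (k : ℤ)
    (H : ∀ c, Kreg F r 𝓜 c → Kreg F r 𝓝 (c + k)) :
    regularity F r 𝓝 ≤ regularity F r 𝓜 + ((k : ℝ) : EReal) := by
  obtain ⟨R⟩ := hN.nonempty_minimalGradedFreeResolution
  refine (iInf_le _ R).trans ?_
  rw [← EReal.sub_le_iff_le_add (Or.inl (EReal.coe_ne_bot _)) (Or.inl (EReal.coe_ne_top _))]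
  refine le_iInf fun R' => ?_
  rw [EReal.sub_le_iff_le_add (Or.inl (EReal.coe_ne_bot _)) (Or.inl (EReal.coe_ne_top _))]
  refine iSup_le fun i => iSup_le fun l => ?_
  by_contra hcon
  rw [not_le] at hcon
  have h1 : ∀ i' (l' : Fin (R'.rank i')), R'.deg i' l' ≤ R.deg i l - i - k - 1 + i' := by
    intro i' l'
    have h2 : (((R'.deg i' l' : ℝ) - (i' : ℝ) : ℝ) : EReal) ≤ R'.regularity :=
      le_iSup_of_le i' (le_iSup_of_le l' le_rfl)
    have h3 := lt_of_le_of_lt (add_le_add_left h2 ((k : ℝ) : EReal)) hcon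
    rw [← EReal.coe_add, EReal.coe_lt_coe_iff] at h3
    have h4 : R'.deg i' l' - i' + k < R.deg i l - i := by exact_mod_cast h3
    omega
  have h5 := R.deg_le hN (H _ (R'.kreg hM h1)) i l
  omega

end

/-! ### The torsion submodule of the irrelevant ideal -/

section

variable {F : Type*} [Field F] {r : ℕ}

theorem exists_eq_sum_X_mul {a : ℕ} {p : PolyRing F r} (hp : p.IsHomogeneous (a + 1)) :
    ∃ q : Fin (r + 1) → PolyRing F r, (∀ i, (q i).IsHomogeneous a) ∧
      p = ∑ i, MvPolynomial.X i * q i := by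
  classical
  have add : ∀ p p' : PolyRing F r,
      (∃ q : Fin (r + 1) → PolyRing F r, (∀ i, (q i).IsHomogeneous a) ∧
        p = ∑ i, MvPolynomial.X i * q i) →
      (∃ q : Fin (r + 1) → PolyRing F r, (∀ i, (q i).IsHomogeneous a) ∧
        p' = ∑ i, MvPolynomial.X i * q i) →
      ∃ q : Fin (r + 1) → PolyRing F r, (∀ i, (q i).IsHomogeneous a) ∧
        p + p' = ∑ i, MvPolynomial.X i * q i := by
    rintro p p' ⟨q, hq, rfl⟩ ⟨q', hq', rfl⟩
    refine ⟨q + q', fun i => (hq i).add (hq' i), ?_⟩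
    rw [← Finset.sum_add_distrib]
    exact Finset.sum_congr rfl fun i _ => (mul_add _ _ _).symm
  rw [p.as_sum]
  refine Finset.sum_induction _ _ add
    ⟨0, fun i => MvPolynomial.isHomogeneous_zero _ _ _, by simp⟩ fun α hα => ?_
  have hdeg : α.degree = a + 1 := by
    have := isForm_iff.1 (isForm_natCast.2 hp) α (MvPolynomial.mem_support_iff.1 hα)
    exact_mod_cast this
  obtain ⟨i, hi⟩ : ∃ i, α i ≠ 0 := by
    by_contra hcon
    push Not at hcon
    have : α = 0 := Finsupp.ext hcon
    simp [this] at hdeg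
  have hα' : Finsupp.single i 1 + (α - Finsupp.single i 1) = α := by
    refine add_tsub_cancel_of_le ?_
    rw [Finsupp.single_le_iff]
    omega
  refine ⟨Pi.single i (MvPolynomial.monomial (α - Finsupp.single i 1) (p.coeff α)), ?_, ?_⟩
  · intro k
    by_cases hk : k = i
    · subst hk
      rw [Pi.single_eq_same]
      refine MvPolynomial.isHomogeneous_monomial _ ?_
      have := congrArg Finsupp.degree hα'
      rw [map_add, Finsupp.degree_single, hdeg] at this
      omega
    · rw [Pi.single_eq_of_ne hk]
      exact MvPolynomial.isHomogeneous_zero _ _ _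
  · rw [Finset.sum_eq_single i]
    · rw [Pi.single_eq_same, MvPolynomial.X, MvPolynomial.monomial_mul, hα', one_mul]
    · intro k _ hk
      rw [Pi.single_eq_of_ne hk, mul_zero]
    · simp

section Modules

variable {M : Type*} [AddCommGroup M] [Module (PolyRing F r) M] {𝓜 : ℤ → AddSubgroup M}

variable (F r M) in
/-- The elements of `M` that are killed by all forms of large degree, that is, by a power of the
irrelevant ideal. -/
def irrelevantTorsion : Submodule (PolyRing F r) M where
  carrier := {m | ∃ k : ℕ, ∀ a, k ≤ a → ∀ p : PolyRing F r, p.IsHomogeneous a → p • m = 0}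
  zero_mem' := ⟨0, fun _ _ _ _ => smul_zero _⟩
  add_mem' := by
    rintro x y ⟨k, hk⟩ ⟨l, hl⟩
    refine ⟨max k l, fun a ha p hp => ?_⟩
    rw [smul_add, hk a (le_of_max_le_left ha) p hp, hl a (le_of_max_le_right ha) p hp, add_zero]
  smul_mem' := by
    rintro c x ⟨k, hk⟩
    exact ⟨k, fun a ha p hp => by rw [smul_comm, hk a ha p hp, smul_zero]⟩

theorem mem_irrelevantTorsion {m : M} : m ∈ irrelevantTorsion F r M ↔
    ∃ k : ℕ, ∀ a, k ≤ a → ∀ p : PolyRing F r, p.IsHomogeneous a → p • m = 0 := Iff.rfl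

theorem mem_irrelevantTorsion_of_X_smul {m : M}
    (h : ∀ i : Fin (r + 1), (MvPolynomial.X i : PolyRing F r) • m ∈ irrelevantTorsion F r M) :
    m ∈ irrelevantTorsion F r M := by
  choose k hk using h
  refine ⟨Finset.univ.sup k + 1, fun a ha p hp => ?_⟩
  obtain ⟨b, rfl⟩ : ∃ b, a = b + 1 := ⟨a - 1, by omega⟩
  obtain ⟨q, hq, rfl⟩ := exists_eq_sum_X_mul hp
  rw [Finset.sum_smul]
  refine Finset.sum_eq_zero fun i _ => ?_
  rw [mul_comm, mul_smul]
  exact hk i b ((Finset.le_sup (Finset.mem_univ i)).trans (by omega)) _ (hq i)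

theorem IsGrading.homogeneous_irrelevantTorsion (h : IsGrading (F := F) (r := r) 𝓜) :
    ∀ x ∈ irrelevantTorsion F r M, ∀ j, h.proj j x ∈ irrelevantTorsion F r M := by
  rintro x ⟨k, hk⟩ j
  refine ⟨k, fun a ha p hp => ?_⟩
  rw [← h.proj_smul hp, hk a ha p hp, map_zero]

/-- If `M` is `c`-regular, its torsion lives in degrees at most `c`: a torsion element has a nonzero
multiple in the socle, which is Koszul homology of top exterior degree. -/
theorem Kreg.eq_zero_of_mem_irrelevantTorsion {c : ℤ} (hc : Kreg F r 𝓜 c)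
    (h : IsGrading (F := F) (r := r) 𝓜) {j : ℤ} (hj : c < j) {m : M} (hm : m ∈ 𝓜 j)
    (hm' : m ∈ irrelevantTorsion F r M) : m = 0 := by
  obtain ⟨k, hk⟩ := hm'
  replace hk := hk k le_rfl
  induction k generalizing j m with
  | zero => simpa using hk 1 (MvPolynomial.isHomogeneous_one _ _)
  | succ k ih =>
    refine eq_zero_of_kvan_top (a := xvar F r) (k := r + 1) hm (fun i _ => ?_)
      (hc _ _ (by push_cast; omega))
    refine ih (j := j + 1) (by omega) (h.xvar_smul_mem i j m hm) fun p hp => ?_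
    rw [smul_smul]
    exact hk _ (hp.mul (isHomogeneous_xvar i))

theorem gradedShortExact_quotient (𝓜 : ℤ → AddSubgroup M) (N : Submodule (PolyRing F r) M) :
    GradedShortExact (fun j => (𝓜 j).comap N.subtype.toAddMonoidHom) 𝓜 (quotientGrading 𝓜 N)
      N.subtype N.mkQ where
  map_f _ _ hx := hx
  map_g _ _ hx := ⟨_, hx, rfl⟩
  comp x := (Submodule.Quotient.mk_eq_zero N).2 x.2
  inj _ hx := Subtype.ext hx
  exact _ x hx hgx := ⟨⟨x, (Submodule.Quotient.mk_eq_zero N).1 hgx⟩, hx, rfl⟩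
  surj _ _ hx := hx

theorem Kreg.quotient_irrelevantTorsion {c : ℤ} (hc : Kreg F r 𝓜 c)
    (h : IsGrading (F := F) (r := r) 𝓜) :
    Kreg F r (quotientGrading 𝓜 (irrelevantTorsion F r M)) c := by
  intro p j hj
  have S := gradedShortExact_quotient 𝓜 (irrelevantTorsion F r M)
  cases p with
  | zero => exact S.kvan_right_zero (hc 0 j hj)
  | succ p =>
    refine S.kvan_right h.xvar_smul_mem (hc _ _ hj) (KVan.of_forall_eq_zero _ _ _ fun x hx => ?_)
    exact Subtype.ext (hc.eq_zero_of_mem_irrelevantTorsion h (by push_cast at hj; omega) hx x.2)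

theorem quotient_irrelevantTorsion_torsionFree {m : M ⧸ irrelevantTorsion F r M}
    (hm : ∀ i : Fin (r + 1), (MvPolynomial.X i : PolyRing F r) • m = 0) : m = 0 := by
  obtain ⟨m, rfl⟩ := Submodule.mkQ_surjective _ m
  rw [Submodule.mkQ_apply, Submodule.Quotient.mk_eq_zero]
  refine mem_irrelevantTorsion_of_X_smul fun i => ?_
  rw [← Submodule.Quotient.mk_eq_zero]
  exact hm i

/-! ### Regularity modulo a nonzerodivisor -/

open scoped Pointwise

theorem kvan_shift {a : ℕ → PolyRing F r} {k p : ℕ} {j : ℤ} (d : ℤ) :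
    KVan a k (fun j => 𝓜 (j - d)) p j ↔ KVan a k 𝓜 p (j - d) := by
  have : ∀ p, kchain (fun j => 𝓜 (j - d)) k p j = kchain 𝓜 k p (j - d) := by
    intro p
    ext z
    simp only [mem_kchain, sub_right_comm]
  rw [KVan, KVan, this, this]

theorem gradedShortExact_smul (h : IsGrading (F := F) (r := r) 𝓜) {d : ℕ} {y : PolyRing F r}
    (hy : y.IsHomogeneous d) (hreg : IsSMulRegular M y) :
    GradedShortExact (fun j => 𝓜 (j - d)) 𝓜
      (quotientGrading 𝓜 (y • (⊤ : Submodule (PolyRing F r) M)))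
      (LinearMap.lsmul (PolyRing F r) M y) (Submodule.mkQ _) where
  map_f j x hx := by
    have := h.smul_mem d _ y x hy hx
    rwa [add_sub_cancel] at this
  map_g _ _ hx := ⟨_, hx, rfl⟩
  comp x := (Submodule.Quotient.mk_eq_zero _).2 (Submodule.smul_mem_pointwise_smul _ _ _ trivial)
  inj x hx := hreg.right_eq_zero_of_smul hx
  exact j x hx hgx := by
    obtain ⟨u, _, rfl⟩ := (Submodule.mem_smul_pointwise_iff_exists _ _ _).1
      ((Submodule.Quotient.mk_eq_zero _).1 hgx)
    refine ⟨h.proj (j - d) u, h.proj_mem _ u, ?_⟩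
    rw [LinearMap.lsmul_apply, ← h.proj_smul' hy, h.proj_of_mem hx]
  surj _ _ hx := hx

theorem IsGrading.homogeneous_smul_top (h : IsGrading (F := F) (r := r) 𝓜) {d : ℕ} {y : PolyRing F r}
    (hy : y.IsHomogeneous d) : ∀ x ∈ y • (⊤ : Submodule (PolyRing F r) M), ∀ j,
      h.proj j x ∈ y • (⊤ : Submodule (PolyRing F r) M) := by
  intro x hx j
  obtain ⟨u, _, rfl⟩ := (Submodule.mem_smul_pointwise_iff_exists _ _ _).1 hx
  rw [h.proj_smul' hy]
  exact Submodule.smul_mem_pointwise_smul _ _ _ trivial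

theorem Kreg.quotient_smul_top {c : ℤ} (hc : Kreg F r 𝓜 c) (h : IsGrading (F := F) (r := r) 𝓜)
    {d : ℕ} (hd : 0 < d) {y : PolyRing F r} (hy : y.IsHomogeneous d) (hreg : IsSMulRegular M y) :
    Kreg F r (quotientGrading 𝓜 (y • (⊤ : Submodule (PolyRing F r) M))) (c + (d - 1)) := by
  intro p j hj
  have S := gradedShortExact_smul h hy hreg
  cases p with
  | zero => exact S.kvan_right_zero (hc 0 j (by omega))
  | succ p =>
    push_cast at hj
    refine S.kvan_right h.xvar_smul_mem (hc _ _ (by push_cast; omega)) ?_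
    rw [kvan_shift]
    exact hc _ _ (by omega)

/-- Forms of positive degree act as zero on Koszul homology. -/
theorem exists_kd_eq_smul (h : IsGrading (F := F) (r := r) 𝓜) {d : ℕ} (hd : 0 < d)
    {y : PolyRing F r} (hy : y.IsHomogeneous d) {p : ℕ} {j : ℤ} {z : KIdx (r + 1) → M}
    (hz : z ∈ kchain 𝓜 (r + 1) p j) (hdz : kd (xvar F r) (r + 1) z = 0) :
    ∃ w ∈ kchain 𝓜 (r + 1) (p + 1) (j + d), kd (xvar F r) (r + 1) w = y • z := by
  obtain ⟨e, rfl⟩ : ∃ e, d = e + 1 := ⟨d - 1, by omega⟩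
  obtain ⟨q, hq, rfl⟩ := exists_eq_sum_X_mul hy
  refine ⟨∑ i : Fin (r + 1), q i • kh M i (r + 1) z, sum_mem fun i _ T => ?_, ?_⟩
  · have h1 := kh_mem (i : ℕ) hz T
    refine ⟨fun hT => ?_, fun hT => ?_⟩
    · have h2 := h.smul_mem e _ _ _ (hq i) (h1.1 hT)
      rw [show (e : ℤ) + (j + 1 - (p + 1 : ℕ)) = j + (e + 1 : ℕ) - (p + 1 : ℕ) by
        push_cast; ring] at h2
      exact h2
    · rw [Pi.smul_apply, h1.2 hT, smul_zero]
  · rw [map_sum, Finset.sum_smul]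
    refine Finset.sum_congr rfl fun i _ => ?_
    have h1 := kd_kh_add_kh_kd (xvar F r) i (r + 1) i.2 z
    rw [hdz, kh_zero, add_zero, xvar_fin] at h1
    rw [map_smul, h1, smul_smul, mul_comm]

theorem Kreg.of_quotient_smul_top (h : IsGrading (F := F) (r := r) 𝓜)
    {d : ℕ} (hd : 0 < d) {y : PolyRing F r} (hy : y.IsHomogeneous d) (hreg : IsSMulRegular M y)
    {c : ℤ} (hc : Kreg F r (quotientGrading 𝓜 (y • (⊤ : Submodule (PolyRing F r) M))) c) :
    Kreg F r 𝓜 (c - (d - 1)) := by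
  intro p j hj
  have S := gradedShortExact_smul h hy hreg
  have : KVan (xvar F r) (r + 1) (fun j => 𝓜 (j - d)) p (j + d) := by
    refine S.kvan_left h.xvar_smul_mem (fun z hz hdz => ?_) (hc _ _ (by push_cast; omega))
    refine exists_kd_eq_smul h hd hy (j := j) (fun T => ?_) hdz
    have h1 : (kdeg (r + 1) T = p → z T ∈ 𝓜 (j + d - p - d)) ∧ (kdeg (r + 1) T ≠ p → z T = 0) := hz T
    rwa [show j + (d : ℤ) - p - d = j - p by ring] at h1
  rwa [kvan_shift, add_sub_cancel_right] at this

/-! ### Finite length -/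

/-- The submodule of elements without components of degree less than `j`. -/
def IsGrading.truncation (h : IsGrading (F := F) (r := r) 𝓜) (j : ℤ) :
    Submodule (PolyRing F r) M where
  carrier := {x | ∀ i, i < j → h.proj i x = 0}
  zero_mem' := fun _ _ => map_zero _
  add_mem' := fun hx hy i hi => by rw [map_add, hx i hi, hy i hi, add_zero]
  smul_mem' := by
    intro p x hx
    induction p using MvPolynomial.induction_on' with
    | monomial u c =>
      intro i hi
      have hu : (MvPolynomial.monomial u c : PolyRing F r).IsHomogeneous u.degree :=
        MvPolynomial.isHomogeneous_monomial _ rfl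
      rw [h.proj_smul' hu, hx _ (by omega), smul_zero]
    | add p q hp hq =>
      intro i hi
      rw [add_smul, map_add, hp i hi, hq i hi, add_zero]

theorem IsGrading.exists_forall_eq_zero_of_isArtinian (h : IsGrading (F := F) (r := r) 𝓜)
    [IsArtinian (PolyRing F r) M] : ∃ k : ℤ, ∀ j, k ≤ j → ∀ x ∈ 𝓜 j, x = 0 := by
  let f : ℕ →o (Submodule (PolyRing F r) M)ᵒᵈ :=
    ⟨fun j => OrderDual.toDual (h.truncation j), fun a b hab x hx i hi => hx i (by omega)⟩
  obtain ⟨k, hk⟩ := IsArtinian.monotone_stabilizes f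
  refine ⟨k, fun j hj x hx => ?_⟩
  obtain ⟨a, rfl⟩ : ∃ a : ℕ, (a : ℤ) = j := ⟨j.toNat, by omega⟩
  have h1 : h.truncation (a : ℤ) = h.truncation ((a + 1 : ℕ) : ℤ) :=
    (hk a (by omega)).symm.trans (hk (a + 1) (by omega))
  have h2 : x ∈ h.truncation (a : ℤ) := fun i hi => h.proj_of_mem_ne hx (by omega)
  rw [h1] at h2
  rw [← h.proj_of_mem hx]
  exact h2 a (by push_cast; omega)

theorem IsGrading.exists_forall_mem_smul_top (h : IsGrading (F := F) (r := r) 𝓜) {d : ℕ}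
    {s : Set (PolyRing F r)} (hs : ∀ f ∈ s, f.IsHomogeneous d)
    (hfin : IsFiniteLength (PolyRing F r)
      (M ⧸ (Ideal.span s • (⊤ : Submodule (PolyRing F r) M)))) :
    ∃ k : ℤ, ∀ j, k ≤ j → ∀ x ∈ 𝓜 j, x ∈ Ideal.span s • (⊤ : Submodule (PolyRing F r) M) := by
  have hN := h.homogeneous_smul hs (N := ⊤) (fun _ _ _ => trivial)
  have := (isFiniteLength_iff_isNoetherian_isArtinian.1 hfin).2
  obtain ⟨k, hk⟩ := (h.quotient hN).exists_forall_eq_zero_of_isArtinian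
  exact ⟨k, fun j hj x hx => (Submodule.Quotient.mk_eq_zero _).1 (hk j hj _ ⟨x, hx, rfl⟩)⟩

end Modules

end

/-! ### The bound over an infinite field -/

section

open scoped Pointwise

section

variable {F : Type*} [Field F] {r : ℕ} {M : Type*} [AddCommGroup M] [Module (PolyRing F r) M]
  {𝓜 : ℤ → AddSubgroup M}

theorem eq_bot_of_lt_zero {x : WithBot ℕ∞} (h : x < ((0 : ℕ) : WithBot ℕ∞)) : x = ⊥ := by
  induction x with
  | bot => rfl
  | coe a => exact absurd h (not_lt.2 (WithBot.coe_le_coe.2 zero_le))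

theorem lt_of_add_one_lt {x : WithBot ℕ∞} {n : ℕ} (h : x + 1 < ((n + 1 : ℕ) : WithBot ℕ∞)) :
    x < (n : WithBot ℕ∞) := by
  induction x with
  | bot => exact WithBot.bot_lt_coe _
  | coe a =>
    have h1 : a + 1 < ((n + 1 : ℕ) : ℕ∞) := WithBot.coe_lt_coe.1 h
    refine WithBot.coe_lt_coe.2 ?_
    push_cast at h1
    exact lt_of_add_lt_add_right h1

theorem IsGrading.exists_forall_X_pow_smul_mem (h : IsGrading (F := F) (r := r) 𝓜)
    [Module.Finite (PolyRing F r) M] (i : Fin (r + 1)) (k : ℤ) :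
    ∃ N : ℕ, ∀ I : Ideal (PolyRing F r),
      (∀ j, k ≤ j → ∀ x ∈ 𝓜 j, x ∈ I • (⊤ : Submodule (PolyRing F r) M)) →
      ∀ x : M, (MvPolynomial.X i : PolyRing F r) ^ N • x ∈ I • (⊤ : Submodule (PolyRing F r) M) := by
  obtain ⟨T, hT, hspan⟩ := h.exists_finset_span
  choose! deg hdeg using hT
  refine ⟨T.sup fun x => (k - deg x).toNat, fun I hI x => ?_⟩
  have hx : x ∈ Submodule.span (PolyRing F r) (T : Set M) := by rw [hspan]; trivial
  induction hx using Submodule.span_induction with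
  | mem x hx =>
    have h1 := h.smul_mem _ _ _ x
      (MvPolynomial.isHomogeneous_X_pow (R := F) i (T.sup fun x => (k - deg x).toNat)) (hdeg x hx)
    refine hI _ ?_ _ h1
    have h2 := Finset.le_sup (f := fun x => (k - deg x).toNat) hx
    have h3 := Int.self_le_toNat (k - deg x)
    omega
  | zero => rw [smul_zero]; exact zero_mem _
  | add x y _ _ hx hy => rw [smul_add]; exact add_mem hx hy
  | smul a x _ hx => rw [smul_comm]; exact Submodule.smul_mem _ _ hx

/-- An ideal `I` with `M_j ⊆ I M` for all large `j` is contained in no associated prime of `M` if no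
nonzero element of `M` is killed by all variables. -/
theorem IsGrading.not_le_of_mem_associatedPrimes (h : IsGrading (F := F) (r := r) 𝓜)
    [Module.Finite (PolyRing F r) M] {I : Ideal (PolyRing F r)}
    (hI : ∃ k : ℤ, ∀ j, k ≤ j → ∀ x ∈ 𝓜 j, x ∈ I • (⊤ : Submodule (PolyRing F r) M))
    (htf : ∀ m : M, (∀ i : Fin (r + 1), (MvPolynomial.X i : PolyRing F r) • m = 0) → m = 0)
    {P : Ideal (PolyRing F r)} (hP : P ∈ associatedPrimes (PolyRing F r) M) : ¬ I ≤ P := by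
  intro hIP
  obtain ⟨hprime, m, rfl⟩ := Submodule.isAssociatedPrime_iff.1 (AssociatedPrimes.mem_iff.1 hP)
  have hmem : ∀ p : PolyRing F r, p ∈ Submodule.colon (⊥ : Submodule (PolyRing F r) M) {m} ↔
      p • m = 0 := fun p => by rw [Submodule.mem_colon_singleton, Submodule.mem_bot]
  refine hprime.ne_top ((Ideal.eq_top_iff_one _).2 ((hmem 1).2 ?_))
  rw [one_smul]
  refine htf m fun i => (hmem _).1 ?_
  obtain ⟨k, hk⟩ := hI
  obtain ⟨N, hN⟩ := h.exists_forall_X_pow_smul_mem i k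
  -- Multiplication by a power of a variable maps `M` into `I M`, so by Cayley-Hamilton that power is
  -- integral over `I` modulo the annihilator of `M`.
  let f : Module.End (PolyRing F r) M := algebraMap _ _ ((MvPolynomial.X i : PolyRing F r) ^ N)
  have hf : LinearMap.range f ≤ I • (⊤ : Submodule (PolyRing F r) M) := by
    rintro _ ⟨x, rfl⟩
    exact hN I hk x
  obtain ⟨p, hp, -, hcoeff, hpf⟩ :=
    LinearMap.exists_monic_and_natDegree_eq_and_coeff_mem_pow_and_aeval_eq_zero
      (PolyRing F r) f I hf
  have h1 : p.eval ((MvPolynomial.X i : PolyRing F r) ^ N) • m = 0 := by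
    have := congrArg (fun g : Module.End (PolyRing F r) M => g m) hpf
    simp only [f, Polynomial.aeval_algebraMap_apply_eq_algebraMap_eval] at this
    simpa [Module.algebraMap_end_apply] using this
  rw [← hmem, Polynomial.eval_eq_sum_range, Finset.sum_range_succ, hp.coeff_natDegree,
    one_mul] at h1
  have h2 : ∑ k ∈ Finset.range p.natDegree,
      p.coeff k * ((MvPolynomial.X i : PolyRing F r) ^ N) ^ k ∈
      Submodule.colon (⊥ : Submodule (PolyRing F r) M) {m} := by
    refine sum_mem fun k hk => Ideal.mul_mem_right _ _ (hIP ?_)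
    have : p.natDegree - k ≠ 0 := by have := Finset.mem_range.1 hk; omega
    exact Ideal.pow_le_self this (hcoeff k)
  have h3 := (Submodule.add_mem_iff_right _ h2).1 h1
  rw [← pow_mul] at h3
  exact hprime.mem_of_pow_mem _ h3

theorem IsGrading.exists_isSMulRegular [Infinite F] (h : IsGrading (F := F) (r := r) 𝓜)
    [Module.Finite (PolyRing F r) M] {d : ℕ} {s : Set (PolyRing F r)}
    (hs : ∀ f ∈ s, f.IsHomogeneous d)
    (hI : ∃ k : ℤ, ∀ j, k ≤ j → ∀ x ∈ 𝓜 j, x ∈ Ideal.span s • (⊤ : Submodule (PolyRing F r) M))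
    (htf : ∀ m : M, (∀ i : Fin (r + 1), (MvPolynomial.X i : PolyRing F r) • m = 0) → m = 0) :
    ∃ y ∈ Ideal.span s, y.IsHomogeneous d ∧ IsSMulRegular M y := by
  classical
  let V : Submodule F (PolyRing F r) := Submodule.span F s
  have hfin := associatedPrimes.finite (PolyRing F r) M
  let W : Ideal (PolyRing F r) → Submodule F V := fun P => (P.restrictScalars F).comap V.subtype
  have hW : ⊤ ∉ hfin.toFinset.image W := by
    intro htop
    obtain ⟨P, hP, hWP⟩ := Finset.mem_image.1 htop
    refine h.not_le_of_mem_associatedPrimes hI htf (hfin.mem_toFinset.1 hP) ?_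
    rw [Ideal.span_le]
    intro f hf
    have : (⟨f, Submodule.subset_span hf⟩ : V) ∈ W P := by rw [hWP]; trivial
    exact this
  have hne := Subspace.biUnion_ne_univ_of_top_notMem hW
  obtain ⟨y, hy⟩ := (Set.ne_univ_iff_exists_notMem _).1 hne
  refine ⟨y.1, ?_, ?_, ?_⟩
  · have : V ≤ (Ideal.span s).restrictScalars F := Submodule.span_le.2 Ideal.subset_span
    exact this y.2
  · have : V ≤ MvPolynomial.homogeneousSubmodule (Fin (r + 1)) F d :=
      Submodule.span_le.2 fun f hf => hs f hf
    exact this y.2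
  · by_contra hcon
    have h1 : (y : PolyRing F r) ∈ {a : PolyRing F r | IsSMulRegular M a}ᶜ := hcon
    rw [← biUnion_associatedPrimes_eq_compl_regular] at h1
    obtain ⟨P, hP, hyP⟩ := Set.mem_iUnion₂.1 h1
    exact hy (Set.mem_iUnion₂.2
      ⟨W P, Finset.mem_image_of_mem W (hfin.mem_toFinset.2 hP), hyP⟩)

theorem forall_mem_smul_top_quotient {I : Ideal (PolyRing F r)} {N : Submodule (PolyRing F r) M}
    {j : ℤ} (h : ∀ x ∈ 𝓜 j, x ∈ I • (⊤ : Submodule (PolyRing F r) M)) :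
    ∀ x ∈ quotientGrading 𝓜 N j, x ∈ I • (⊤ : Submodule (PolyRing F r) (M ⧸ N)) := by
  rintro _ ⟨x, hx, rfl⟩
  have := Submodule.mem_map_of_mem (f := N.mkQ) (h x hx)
  rw [Submodule.map_smul''] at this
  exact Submodule.smul_mono le_rfl le_top this

/-- If the image of `x` in `M ⧸ N` lies in `I (M ⧸ N)`, then a homogeneous `x` is congruent
modulo `I M` to a homogeneous element of `N`. -/
theorem IsGrading.exists_sub_mem (h : IsGrading (F := F) (r := r) 𝓜)
    {I : Ideal (PolyRing F r)} {N : Submodule (PolyRing F r) M}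
    (hI : ∀ x ∈ I • (⊤ : Submodule (PolyRing F r) M), ∀ j,
      h.proj j x ∈ I • (⊤ : Submodule (PolyRing F r) M))
    {j : ℤ} {x : M} (hx : x ∈ 𝓜 j) (hxI : N.mkQ x ∈ I • (⊤ : Submodule (PolyRing F r) (M ⧸ N))) :
    ∃ u ∈ N, x - h.proj j u ∈ I • (⊤ : Submodule (PolyRing F r) M) := by
  rw [← Submodule.range_mkQ N, ← Submodule.map_top, ← Submodule.map_smul''] at hxI
  obtain ⟨v, hv, hvx⟩ := hxI
  refine ⟨x - v, ?_, ?_⟩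
  · rw [← Submodule.Quotient.mk_eq_zero, ← Submodule.mkQ_apply, map_sub, hvx, sub_self]
  · rw [map_sub, h.proj_of_mem hx, sub_sub_cancel]
    exact hI v hv j

end

/-- The bound for the degrees of `M ⧸ I ^ t M`, by induction on the dimension: after dividing out the
torsion, `I` contains a nonzerodivisor `y` of degree `d`, and modulo `y` the dimension drops while
the regularity grows by at most `d - 1`. -/
theorem mem_pow_smul_top_of_infinite {F : Type*} [Field F] [Infinite F] {r : ℕ} {d : ℕ} (hd : 0 < d)
    {s : Set (PolyRing F r)} (hs : ∀ f ∈ s, f.IsHomogeneous d) (n : ℕ) :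
    ∀ {M : Type*} [AddCommGroup M] [Module (PolyRing F r) M] [Module.Finite (PolyRing F r) M]
      {𝓜 : ℤ → AddSubgroup M} (_ : IsGrading (F := F) (r := r) 𝓜)
      (_ : Module.supportDim (PolyRing F r) M < (n : WithBot ℕ∞)) {c : ℤ} (_ : Kreg F r 𝓜 c)
      (_ : ∃ k : ℤ, ∀ j, k ≤ j → ∀ x ∈ 𝓜 j,
        x ∈ Ideal.span s • (⊤ : Submodule (PolyRing F r) M)) {t : ℕ} (_ : 0 < t) {j : ℤ}
      (_ : t * d + c + ((n : ℤ) - 2) * (d - 1) - 1 < j),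
      ∀ x ∈ 𝓜 j, x ∈ Ideal.span s ^ t • (⊤ : Submodule (PolyRing F r) M) := by
  induction n with
  | zero =>
    intro M _ _ _ 𝓜 h hdim c hc hI t ht j hj x hx
    have : Subsingleton M := by
      rw [← Module.supportDim_eq_bot_iff_subsingleton (R := PolyRing F r)]
      exact eq_bot_of_lt_zero hdim
    rw [Subsingleton.elim x 0]
    exact zero_mem _
  | succ n ih =>
    intro M _ _ _ 𝓜 h hdim c hc hI t ht j hj x hx
    let Γ := irrelevantTorsion F r M
    have hΓ := h.quotient h.homogeneous_irrelevantTorsion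
    have hIΓ : ∃ k : ℤ, ∀ j, k ≤ j → ∀ x ∈ quotientGrading 𝓜 Γ j,
        x ∈ Ideal.span s • (⊤ : Submodule (PolyRing F r) (M ⧸ Γ)) := by
      obtain ⟨k, hk⟩ := hI
      exact ⟨k, fun j hj => forall_mem_smul_top_quotient (hk j hj)⟩
    have hcΓ := hc.quotient_irrelevantTorsion h
    obtain ⟨y, hyI, hy, hreg⟩ := hΓ.exists_isSMulRegular hs hIΓ
      fun m hm => quotient_irrelevantTorsion_torsionFree hm
    let Y : Submodule (PolyRing F r) (M ⧸ Γ) := y • ⊤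
    have hdimY : Module.supportDim (PolyRing F r) ((M ⧸ Γ) ⧸ Y) < (n : WithBot ℕ∞) := by
      have h1 := Module.supportDim_quotSMulTop_succ_le_of_notMem_minimalPrimes (R := PolyRing F r)
        (M := M ⧸ Γ) (fun p hp => hreg.notMem_of_mem_minimalPrimes hp)
      have h2 := Module.supportDim_le_of_surjective (R := PolyRing F r) Γ.mkQ Γ.mkQ_surjective
      exact lt_of_add_one_lt ((h1.trans h2).trans_lt hdim)
    have hIY : ∃ k : ℤ, ∀ j, k ≤ j → ∀ x ∈ quotientGrading (quotientGrading 𝓜 Γ) Y j,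
        x ∈ Ideal.span s • (⊤ : Submodule (PolyRing F r) ((M ⧸ Γ) ⧸ Y)) := by
      obtain ⟨k, hk⟩ := hIΓ
      exact ⟨k, fun j hj => forall_mem_smul_top_quotient (hk j hj)⟩
    have key : ∀ (t : ℕ) (j : ℤ), t * d + c + ((n : ℤ) - 1) * (d - 1) - 1 < j →
        ∀ x ∈ quotientGrading 𝓜 Γ j,
          x ∈ Ideal.span s ^ t • (⊤ : Submodule (PolyRing F r) (M ⧸ Γ)) := by
      intro t
      induction t with
      | zero => intro j _ x _; simp
      | succ t iht =>
        intro j hj x hx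
        have h1 := ih (hΓ.quotient (hΓ.homogeneous_smul_top hy)) hdimY
          (hcΓ.quotient_smul_top hΓ hd hy hreg) hIY (t := t + 1) (Nat.succ_pos t) (j := j)
          (by refine lt_of_eq_of_lt ?_ hj; push_cast; ring) _ ⟨x, hx, rfl⟩
        obtain ⟨_, hu, hxu⟩ := hΓ.exists_sub_mem (hΓ.homogeneous_pow_smul_top hs _) hx h1
        obtain ⟨u, _, rfl⟩ := (Submodule.mem_smul_pointwise_iff_exists _ _ _).1 hu
        rw [hΓ.proj_smul' hy] at hxu
        have h2 := iht (j - d) (by push_cast at hj; linarith) _ (hΓ.proj_mem (j - d) u)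
        have h3 := Submodule.smul_mem_smul hyI h2
        rw [← Submodule.mul_smul, ← pow_succ'] at h3
        simpa using add_mem hxu h3
    obtain ⟨u, hu, hxu⟩ := h.exists_sub_mem (h.homogeneous_pow_smul_top hs _) hx
      (key t j (by refine lt_of_eq_of_lt ?_ hj; push_cast; ring) _ ⟨x, hx, rfl⟩)
    have h0 : h.proj j u = 0 := by
      refine hc.eq_zero_of_mem_irrelevantTorsion h (j := j) ?_ (h.proj_mem j u)
        (h.homogeneous_irrelevantTorsion u hu j)
      refine lt_of_le_of_lt ?_ hj
      have h1 : (1 : ℤ) ≤ t := by exact_mod_cast ht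
      have h2 : (1 : ℤ) ≤ d := by exact_mod_cast hd
      have h3 : (0 : ℤ) ≤ n := Int.natCast_nonneg n
      push_cast
      nlinarith [mul_nonneg (sub_nonneg.2 h1) (sub_nonneg.2 h2), mul_nonneg h3 (sub_nonneg.2 h2)]
    rwa [h0, sub_zero] at hxu

end

/-! ### Extension of the base field -/

section

/-- The Krull dimension does not grow along integral ring homomorphisms. -/
theorem ringKrullDim_le_of_isIntegral {A B : Type*} [CommRing A] [CommRing B] (f : A →+* B)
    (hf : f.IsIntegral) : ringKrullDim B ≤ ringKrullDim A := by
  let _ := f.toAlgebra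
  have : Algebra.IsIntegral A B := ⟨hf⟩
  refine Order.krullDim_le_of_strictMono (PrimeSpectrum.comap f) fun p q hpq => ?_
  exact Ideal.IsIntegral.comap_lt_comap (R := A) hpq

open TensorProduct MvPolynomial

attribute [local instance] MvPolynomial.algebraMvPolynomial

section

variable {F : Type*} [Field F] {r : ℕ} {K : Type*} [Field K] [Algebra F K]
  {M : Type*} [AddCommGroup M] [Module (PolyRing F r) M] {𝓜 : ℤ → AddSubgroup M}

variable (F r K) in
theorem isBaseChange_polyRing :
    IsBaseChange (PolyRing F r) (IsScalarTower.toAlgHom F K (PolyRing K r)).toLinearMap :=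
  (inferInstance : Algebra.IsPushout F (PolyRing F r) K (PolyRing K r)).out

variable (r) in
/-- The `F[x]`-linear extension `K[x] → F[x]` of an `F`-linear functional on `K`. -/
def polyFunctional (g : K →ₗ[F] F) : PolyRing K r →ₗ[PolyRing F r] PolyRing F r :=
  (isBaseChange_polyRing F r K).lift ((Algebra.linearMap F (PolyRing F r)).comp g)

theorem polyFunctional_C (g : K →ₗ[F] F) (c : K) :
    polyFunctional r g (C c) = C (g c) :=
  (isBaseChange_polyRing F r K).lift_eq _ c

variable (M) in
/-- The `F[x]`-linear extension `K[x] ⊗ M → M` of an `F`-linear functional on `K`. -/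
def tensorFunctional (g : K →ₗ[F] F) :
    PolyRing K r ⊗[PolyRing F r] M →ₗ[PolyRing F r] M :=
  (TensorProduct.lid (PolyRing F r) M).toLinearMap ∘ₗ (polyFunctional r g).rTensor M

theorem tensorFunctional_tmul (g : K →ₗ[F] F) (p : PolyRing K r) (m : M) :
    tensorFunctional M g (p ⊗ₜ m) = polyFunctional r g p • m := by
  simp [tensorFunctional]

theorem tensorFunctional_C_tmul (g : K →ₗ[F] F) (c : K) (m : M) :
    tensorFunctional M g ((C c : PolyRing K r) ⊗ₜ m) = (C (g c) : PolyRing F r) • m := by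
  rw [tensorFunctional_tmul, polyFunctional_C]

variable {ι : Type*} (b : Module.Basis ι F K)

theorem exists_sum_polyFunctional (p : PolyRing K r) : ∃ B : Finset ι, ∀ B', B ⊆ B' →
    p = ∑ i ∈ B', polyFunctional r (b.coord i) p • (C (b i) : PolyRing K r) := by
  classical
  induction p using (isBaseChange_polyRing F r K).inductionOn with
  | zero => exact ⟨∅, fun B' _ => by simp⟩
  | tmul c =>
    refine ⟨(b.repr c).support, fun B' hB' => ?_⟩
    change C c = ∑ i ∈ B', polyFunctional r (b.coord i) (C c) • (C (b i) : PolyRing K r)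
    have h1 : c = ∑ i ∈ B', b.repr c i • b i := by
      conv_lhs => rw [← b.linearCombination_repr c, Finsupp.linearCombination_apply]
      exact Finsupp.sum_of_support_subset _ hB' _ (fun i _ => zero_smul _ _)
    conv_lhs => rw [h1, map_sum]
    refine Finset.sum_congr rfl fun i _ => ?_
    rw [polyFunctional_C, Algebra.smul_def, Algebra.smul_def, map_mul]
    congr 1
    exact (MvPolynomial.map_C _ _).symm
  | smul a p hp =>
    obtain ⟨B, hB⟩ := hp
    refine ⟨B, fun B' hB' => ?_⟩
    conv_lhs => rw [hB B' hB', Finset.smul_sum]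
    refine Finset.sum_congr rfl fun i _ => ?_
    rw [map_smul, smul_smul, smul_eq_mul]
  | add p q hp hq =>
    obtain ⟨B, hB⟩ := hp
    obtain ⟨D, hD⟩ := hq
    refine ⟨B ∪ D, fun B' hB' => ?_⟩
    conv_lhs => rw [hB B' (Finset.union_subset_left hB'), hD B' (Finset.union_subset_right hB'),
      ← Finset.sum_add_distrib]
    refine Finset.sum_congr rfl fun i _ => ?_
    rw [map_add, add_smul]

/-- An element of `K[x] ⊗ M` is determined by its coordinates with respect to a basis of `K`. -/
theorem exists_sum_tensorFunctional (x : PolyRing K r ⊗[PolyRing F r] M) :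
    ∃ B : Finset ι, ∀ B', B ⊆ B' →
      x = ∑ i ∈ B', (C (b i) : PolyRing K r) ⊗ₜ tensorFunctional M (b.coord i) x := by
  classical
  induction x using TensorProduct.induction_on with
  | zero => exact ⟨∅, fun B' _ => by simp⟩
  | tmul p m =>
    obtain ⟨B, hB⟩ := exists_sum_polyFunctional b p
    refine ⟨B, fun B' hB' => ?_⟩
    conv_lhs => rw [hB B' hB', TensorProduct.sum_tmul]
    refine Finset.sum_congr rfl fun i _ => ?_
    rw [tensorFunctional_tmul, TensorProduct.smul_tmul]
  | add p q hp hq =>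
    obtain ⟨B, hB⟩ := hp
    obtain ⟨D, hD⟩ := hq
    refine ⟨B ∪ D, fun B' hB' => ?_⟩
    conv_lhs => rw [hB B' (Finset.union_subset_left hB'), hD B' (Finset.union_subset_right hB'),
      ← Finset.sum_add_distrib]
    refine Finset.sum_congr rfl fun i _ => ?_
    rw [map_add, TensorProduct.tmul_add]

/-- The grading of `K[x] ⊗ M`: an element is homogeneous of degree `j` if all its coordinates with
respect to a basis of `K` are. -/
def tensorGrading (𝓜 : ℤ → AddSubgroup M) : ℤ → AddSubgroup (PolyRing K r ⊗[PolyRing F r] M) :=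
  fun j => ⨅ i, (𝓜 j).comap (tensorFunctional M (b.coord i)).toAddMonoidHom

theorem mem_tensorGrading {j : ℤ} {x : PolyRing K r ⊗[PolyRing F r] M} :
    x ∈ tensorGrading b 𝓜 j ↔ ∀ i, tensorFunctional M (b.coord i) x ∈ 𝓜 j := by
  rw [tensorGrading, AddSubgroup.mem_iInf]
  rfl

theorem IsGrading.C_tmul_mem (h : IsGrading (F := F) (r := r) 𝓜) (c : K) {j : ℤ} {m : M}
    (hm : m ∈ 𝓜 j) : (C c : PolyRing K r) ⊗ₜ[PolyRing F r] m ∈ tensorGrading b 𝓜 j := by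
  rw [mem_tensorGrading]
  intro i
  rw [tensorFunctional_C_tmul]
  have := h.smul_mem 0 j _ m (isHomogeneous_C (Fin (r + 1)) (b.coord i c)) hm
  rwa [Nat.cast_zero, zero_add] at this

theorem IsGrading.tensor (h : IsGrading (F := F) (r := r) 𝓜) :
    IsGrading (F := K) (r := r) (tensorGrading (r := r) b 𝓜) := by
  refine IsGrading.of_indep ?_ ?_ ?_
  · intro s f hf hs j hj
    obtain ⟨B, hB⟩ := exists_sum_tensorFunctional b (f j)
    rw [hB B subset_rfl]
    refine Finset.sum_eq_zero fun i _ => ?_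
    have h1 : ∑ j ∈ s, tensorFunctional M (b.coord i) (f j) ∈ (⊥ : Submodule (PolyRing F r) M) := by
      rw [← map_sum, hs, map_zero]
      exact zero_mem _
    have h2 := h.sum_eq_zero (f := fun j => tensorFunctional M (b.coord i) (f j))
      (fun j => (mem_tensorGrading b).1 (hf j) i) (N := ⊥) (by simp) h1 hj
    rw [(Submodule.mem_bot _).1 h2, TensorProduct.tmul_zero]
  · intro x
    obtain ⟨B, hB⟩ := exists_sum_tensorFunctional b x
    rw [hB B subset_rfl]
    refine sum_mem fun i _ => ?_
    generalize tensorFunctional M (b.coord i) x = m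
    induction m using h.induction with
    | zero => rw [TensorProduct.tmul_zero]; exact zero_mem _
    | add x y hx hy => rw [TensorProduct.tmul_add]; exact add_mem hx hy
    | hom j x hx => exact AddSubgroup.mem_iSup_of_mem j (h.C_tmul_mem b _ hx)
  · intro a j p x hp hx
    obtain ⟨B, hB⟩ := exists_sum_tensorFunctional b x
    rw [hB B subset_rfl, Finset.smul_sum]
    refine sum_mem fun i _ => ?_
    have hm := (mem_tensorGrading b).1 hx i
    generalize tensorFunctional M (b.coord i) x = m at hm
    rw [p.as_sum, Finset.sum_smul]
    refine sum_mem fun α hα => ?_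
    have hα' : (monomial α (1 : F) : PolyRing F r).IsHomogeneous a := by
      refine isHomogeneous_monomial _ ?_
      have := isForm_iff.1 (isForm_natCast.2 hp) α (mem_support_iff.1 hα)
      exact_mod_cast this
    have h1 : (monomial α (p.coeff α) : PolyRing K r) • ((C (b i) : PolyRing K r) ⊗ₜ m) =
        (C (p.coeff α * b i) : PolyRing K r) ⊗ₜ[PolyRing F r]
          ((monomial α (1 : F) : PolyRing F r) • m) := by
      rw [← TensorProduct.smul_tmul, TensorProduct.smul_tmul']
      congr 1
      rw [smul_eq_mul, Algebra.smul_def]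
      change _ = MvPolynomial.map (algebraMap F K) (monomial α 1) * _
      rw [MvPolynomial.map_monomial, map_one, mul_comm, C_mul_monomial, mul_comm (monomial α 1),
        C_mul_monomial, mul_one, mul_comm (b i)]
    rw [h1]
    exact h.C_tmul_mem b _ (h.smul_mem a j _ m hα' hm)

theorem algebraMap_xvar (i : ℕ) :
    algebraMap (PolyRing F r) (PolyRing K r) (xvar F r i) = xvar K r i := by
  change MvPolynomial.map (algebraMap F K) (xvar F r i) = _
  unfold xvar
  split_ifs
  · exact MvPolynomial.map_X _ _
  · exact map_zero _

theorem xvar_smul_tensor (i : ℕ) (x : PolyRing K r ⊗[PolyRing F r] M) :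
    xvar K r i • x = xvar F r i • x := by
  rw [← algebraMap_xvar (F := F), algebraMap_smul]

theorem Kreg.tensor {c : ℤ} (hc : Kreg F r 𝓜 c) (h : IsGrading (F := F) (r := r) 𝓜) :
    Kreg K r (tensorGrading (r := r) b 𝓜) c := by
  classical
  intro p j hj z hz hdz
  have h1 : ∀ i, (fun T => tensorFunctional M (b.coord i) (z T)) ∈ kchain 𝓜 (r + 1) p j :=
    fun i T => ⟨fun hT => (mem_tensorGrading b).1 ((hz T).1 hT) i,
      fun hT => (congrArg _ ((hz T).2 hT)).trans (map_zero _)⟩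
  have h2 : ∀ i, ∃ w ∈ kchain 𝓜 (r + 1) (p + 1) j,
      kd (xvar F r) (r + 1) w = fun T => tensorFunctional M (b.coord i) (z T) := by
    intro i
    refine hc p j hj _ (h1 i) ?_
    have := kd_comp (xvar K r) (xvar F r) (tensorFunctional M (b.coord i)).toAddMonoidHom
      (fun l x => by
        rw [xvar_smul_tensor]
        exact map_smul (tensorFunctional M (b.coord i)) _ _) (r + 1) z
    refine this.trans ?_
    rw [hdz]
    exact funext fun _ => (tensorFunctional (r := r) M (b.coord i)).map_zero
  choose w hw hdw using h2
  have h3 : ∃ B : Finset ι, ∀ T,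
      z T = ∑ i ∈ B, (C (b i) : PolyRing K r) ⊗ₜ tensorFunctional M (b.coord i) (z T) := by
    have := Fintype.ofFinite (KIdx (r + 1))
    choose B hB using fun T =>
      exists_sum_tensorFunctional (r := r) (M := M) b (z T)
    exact ⟨Finset.univ.biUnion B, fun T => hB T _ (Finset.subset_biUnion_of_mem B (Finset.mem_univ T))⟩
  obtain ⟨B, hB⟩ := h3
  let φ : ι → M →+ PolyRing K r ⊗[PolyRing F r] M := fun i =>
    (TensorProduct.mk (PolyRing F r) (PolyRing K r) M (C (b i))).toAddMonoidHom
  refine ⟨∑ i ∈ B, fun T => φ i (w i T), sum_mem fun i _ T => ?_, ?_⟩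
  · exact ⟨fun hT => h.C_tmul_mem b _ ((hw i T).1 hT),
      fun hT => (congrArg _ ((hw i T).2 hT)).trans (map_zero (φ i))⟩
  · rw [map_sum]
    funext T
    rw [Finset.sum_apply, hB T]
    refine Finset.sum_congr rfl fun i _ => ?_
    have := kd_comp (xvar F r) (xvar K r) (φ i) (fun l x => by
      rw [xvar_smul_tensor]
      exact map_smul (TensorProduct.mk (PolyRing F r) (PolyRing K r) M (C (b i))) _ _) (r + 1) (w i)
    rw [this, hdw]
    rfl

/-- The dimension does not grow under an algebraic extension of the base field. -/
theorem supportDim_tensor_le [Algebra.IsIntegral F K] [Module.Finite (PolyRing F r) M] :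
    Module.supportDim (PolyRing K r) (PolyRing K r ⊗[PolyRing F r] M) ≤
      Module.supportDim (PolyRing F r) M := by
  rw [Module.supportDim_eq_ringKrullDim_quotient_annihilator,
    Module.supportDim_eq_ringKrullDim_quotient_annihilator]
  have hann : Module.annihilator (PolyRing F r) M ≤
      (Module.annihilator (PolyRing K r) (PolyRing K r ⊗[PolyRing F r] M)).comap
        (algebraMap (PolyRing F r) (PolyRing K r)) := by
    intro a ha
    rw [Ideal.mem_comap, Module.mem_annihilator]
    intro x
    rw [algebraMap_smul]
    induction x using TensorProduct.induction_on with
    | zero => exact smul_zero _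
    | tmul p m => rw [TensorProduct.smul_tmul', TensorProduct.smul_tmul,
        Module.mem_annihilator.1 ha, TensorProduct.tmul_zero]
    | add x y hx hy => rw [smul_add, hx, hy, add_zero]
  have hint : (algebraMap (PolyRing F r) (PolyRing K r)).IsIntegral :=
    algebraMap_isIntegral_iff.2 inferInstance
  refine ringKrullDim_le_of_isIntegral (Ideal.quotientMap _ _ hann) ?_
  refine RingHom.IsIntegral.tower_top (Ideal.Quotient.mk _) _ ?_
  rw [Ideal.quotientMap_comp_mk]
  exact RingHom.IsIntegral.trans _ _ hint
    (RingHom.isIntegral_of_surjective _ Ideal.Quotient.mk_surjective)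

variable (K) in
theorem span_image_algebraMap (s : Set (PolyRing F r)) :
    Ideal.span (algebraMap (PolyRing F r) (PolyRing K r) '' s) =
      (Ideal.span s).map (algebraMap (PolyRing F r) (PolyRing K r)) :=
  (Ideal.map_span _ _).symm

theorem tmul_mem_smul_top {I : Ideal (PolyRing F r)} {m : M}
    (hm : m ∈ I • (⊤ : Submodule (PolyRing F r) M)) (p : PolyRing K r) :
    p ⊗ₜ[PolyRing F r] m ∈ I.map (algebraMap (PolyRing F r) (PolyRing K r)) •
      (⊤ : Submodule (PolyRing K r) (PolyRing K r ⊗[PolyRing F r] M)) := by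
  refine Submodule.smul_induction_on hm ?_ ?_
  · intro a ha m _
    rw [TensorProduct.tmul_smul, ← algebraMap_smul (PolyRing K r) a]
    exact Submodule.smul_mem_smul (Ideal.mem_map_of_mem _ ha) trivial
  · intro x y hx hy
    rw [TensorProduct.tmul_add]
    exact add_mem hx hy

theorem tensorFunctional_mem_smul_top (g : K →ₗ[F] F) {I : Ideal (PolyRing F r)}
    {x : PolyRing K r ⊗[PolyRing F r] M}
    (hx : x ∈ I.map (algebraMap (PolyRing F r) (PolyRing K r)) •
      (⊤ : Submodule (PolyRing K r) (PolyRing K r ⊗[PolyRing F r] M))) :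
    tensorFunctional M g x ∈ I • (⊤ : Submodule (PolyRing F r) M) := by
  refine Submodule.smul_induction_on hx ?_ ?_
  · intro a ha y _
    rw [Ideal.map] at ha
    induction ha using Submodule.span_induction generalizing y with
    | mem a ha =>
      obtain ⟨a, ha, rfl⟩ := ha
      rw [algebraMap_smul, map_smul]
      exact Submodule.smul_mem_smul ha trivial
    | zero => rw [zero_smul, map_zero]; exact zero_mem _
    | add p q _ _ hp hq => rw [add_smul, map_add]; exact add_mem (hp _ trivial) (hq _ trivial)
    | smul a p _ hp => rw [smul_eq_mul, mul_comm, mul_smul]; exact hp _ trivial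
  · intro x y hx hy
    rw [map_add]
    exact add_mem hx hy

end

/-- The bound of `mem_pow_smul_top_of_infinite` over an arbitrary field, by passing to the algebraic
closure. -/
theorem mem_pow_smul_top {F : Type*} [Field F] {r : ℕ} {d : ℕ} (hd : 0 < d)
    {s : Set (PolyRing F r)} (hs : ∀ f ∈ s, f.IsHomogeneous d) {n : ℕ}
    {M : Type*} [AddCommGroup M] [Module (PolyRing F r) M] [Module.Finite (PolyRing F r) M]
    {𝓜 : ℤ → AddSubgroup M} (h : IsGrading (F := F) (r := r) 𝓜)
    (hdim : Module.supportDim (PolyRing F r) M < (n : WithBot ℕ∞)) {c : ℤ} (hc : Kreg F r 𝓜 c)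
    (hI : ∃ k : ℤ, ∀ j, k ≤ j → ∀ x ∈ 𝓜 j,
      x ∈ Ideal.span s • (⊤ : Submodule (PolyRing F r) M)) {t : ℕ} (ht : 0 < t) {j : ℤ}
    (hj : t * d + c + ((n : ℤ) - 2) * (d - 1) - 1 < j) :
    ∀ x ∈ 𝓜 j, x ∈ Ideal.span s ^ t • (⊤ : Submodule (PolyRing F r) M) := by
  let K := AlgebraicClosure F
  have : Infinite K := inferInstance
  let b := Module.Basis.ofVectorSpace F K
  obtain ⟨g, hg⟩ : ∃ g : K →ₗ[F] F, g 1 = 1 := by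
    obtain ⟨g, hg⟩ := LinearMap.exists_leftInverse_of_injective (Algebra.linearMap F K)
      (LinearMap.ker_eq_bot.2 (algebraMap F K).injective)
    refine ⟨g, ?_⟩
    have := LinearMap.congr_fun hg 1
    simpa using this
  intro x hx
  have h1 := mem_pow_smul_top_of_infinite (F := K) (r := r) hd
    (s := algebraMap (PolyRing F r) (PolyRing K r) '' s) (by
      rintro _ ⟨f, hf, rfl⟩
      exact (hs f hf).map _) n (h.tensor b) (supportDim_tensor_le.trans_lt hdim) (hc.tensor b h) (by
      obtain ⟨k, hk⟩ := hI
      refine ⟨k, fun j hj x hx => ?_⟩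
      obtain ⟨B, hB⟩ := exists_sum_tensorFunctional b x
      rw [hB B subset_rfl, span_image_algebraMap]
      exact sum_mem fun i _ => tmul_mem_smul_top (hk j hj _ ((mem_tensorGrading b).1 hx i)) _)
    ht hj _ (h.C_tmul_mem b 1 hx)
  rw [span_image_algebraMap, ← Ideal.map_pow] at h1
  have h2 := tensorFunctional_mem_smul_top g h1
  rwa [tensorFunctional_C_tmul, hg, map_one, one_smul] at h2

end

/-! ### The dimension is at most the number of equations -/

section

variable {F : Type*} [Field F] {r : ℕ} {M : Type*} [AddCommGroup M] [Module (PolyRing F r) M]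
  {𝓜 : ℤ → AddSubgroup M}

/-- If forms `f i` of positive degree `d` satisfy `M_j ⊆ (f) M` for all large `j`, then `M` is
generated as a module over the polynomial ring in the `f i` by finitely many products of monomials
with homogeneous generators of `M`. -/
theorem IsGrading.exists_finite_generators (h : IsGrading (F := F) (r := r) 𝓜)
    [Module.Finite (PolyRing F r) M] {d : ℕ} (hd : 0 < d) {s : Set (PolyRing F r)}
    (hs : ∀ f ∈ s, f.IsHomogeneous d)
    (hI : ∃ k : ℤ, ∀ j, k ≤ j → ∀ x ∈ 𝓜 j, x ∈ Ideal.span s • (⊤ : Submodule (PolyRing F r) M)) :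
    ∃ W : Set M, W.Finite ∧ ∀ N : AddSubgroup M, W ⊆ N →
      (∀ (c : F) (x : M), x ∈ N → (MvPolynomial.C c : PolyRing F r) • x ∈ N) →
      (∀ f ∈ s, ∀ x ∈ N, f • x ∈ N) → ∀ x, x ∈ N := by
  obtain ⟨k, hk⟩ := hI
  obtain ⟨T, hT, hspan⟩ := h.exists_finset_span
  choose! deg hdeg using hT
  refine ⟨⋃ x ∈ T, (fun α => (MvPolynomial.monomial α 1 : PolyRing F r) • x) ''
    {α | α.degree ≤ (k - deg x).toNat}, ?_, ?_⟩
  · exact Set.Finite.biUnion T.finite_toSet fun x _ => (Finsupp.finite_of_degree_le _).image _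
  intro N hW hC hf
  have low : ∀ x : M, ∀ j < k, h.proj j x ∈ N := by
    intro x j hj
    have hx : x ∈ Submodule.span (PolyRing F r) (T : Set M) := by rw [hspan]; trivial
    refine Submodule.span_induction (p := fun x _ => ∀ p : PolyRing F r, h.proj j (p • x) ∈ N)
      ?_ ?_ ?_ ?_ hx 1 |> fun h1 => by rwa [one_smul] at h1
    · intro x hx p
      induction p using MvPolynomial.induction_on' with
      | monomial α c =>
        have hα : (MvPolynomial.monomial α c : PolyRing F r).IsHomogeneous α.degree :=
          MvPolynomial.isHomogeneous_monomial _ rfl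
        have h1 := h.smul_mem _ _ _ x hα (hdeg x hx)
        by_cases hj' : (α.degree : ℤ) + deg x = j
        · subst hj'
          rw [h.proj_of_mem h1]
          have h2 : (MvPolynomial.monomial α c : PolyRing F r) =
              MvPolynomial.C c * MvPolynomial.monomial α 1 := by
            rw [MvPolynomial.C_mul_monomial, mul_one]
          rw [h2, mul_smul]
          refine hC _ _ (hW (Set.mem_iUnion₂.2 ⟨x, hx, α, ?_, rfl⟩))
          change α.degree ≤ _
          omega
        · rw [h.proj_of_mem_ne h1 hj']
          exact zero_mem _
      | add p q hp hq => rw [add_smul, map_add]; exact add_mem hp hq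
    · intro p
      rw [smul_zero, map_zero]
      exact zero_mem _
    · intro x y _ _ hx hy p
      rw [smul_add, map_add]
      exact add_mem (hx p) (hy p)
    · intro a x _ hx p
      rw [smul_smul]
      exact hx _
  have all : ∀ n : ℕ, ∀ j, j < k + n → ∀ x ∈ 𝓜 j, x ∈ N := by
    intro n
    induction n with
    | zero =>
      intro j hj x hx
      rw [← h.proj_of_mem hx]
      exact low x j (by simpa using hj)
    | succ n ih =>
      intro j hj x hx
      by_cases hjk : j < k
      · rw [← h.proj_of_mem hx]
        exact low x j hjk
      · have h1 := h.mem_closure_of_mem_span_smul hs (hk j (not_lt.1 hjk) x hx) hx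
        refine (AddSubgroup.closure_le N).2 ?_ h1
        rintro _ ⟨f, hfs, m, hm, rfl⟩
        refine hf f hfs m (ih (j - d) ?_ m hm)
        push_cast at hj
        omega
  intro x
  obtain ⟨S, hS⟩ := h.exists_sum_proj x
  rw [hS]
  exact sum_mem fun j _ => all (j - k + 1).toNat j (by omega) _ (h.proj_mem j x)

/-- `M` is finite over the polynomial ring in the elements `fs`, so by Cayley-Hamilton
`F[x_0, …, x_r] / Ann M` is integral over it, which bounds the dimension. -/
theorem IsGrading.supportDim_le_length (h : IsGrading (F := F) (r := r) 𝓜)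
    [Module.Finite (PolyRing F r) M] {d : ℕ} (hd : 0 < d) (fs : List (PolyRing F r))
    (hs : ∀ f ∈ fs, f.IsHomogeneous d)
    (hI : ∃ k : ℤ, ∀ j, k ≤ j → ∀ x ∈ 𝓜 j,
      x ∈ Ideal.ofList fs • (⊤ : Submodule (PolyRing F r) M)) :
    Module.supportDim (PolyRing F r) M ≤ (fs.length : WithBot ℕ∞) := by
  obtain ⟨W, hWfin, hW⟩ := h.exists_finite_generators hd hs hI
  let A := MvPolynomial (Fin fs.length) F
  let ψ : A →ₐ[F] PolyRing F r := MvPolynomial.aeval fun i => fs.get i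
  let _ : Module A M := Module.compHom M ψ.toRingHom
  have smul_def : ∀ (a : A) (x : M), a • x = ψ a • x := fun _ _ => rfl
  have hfin : Module.Finite A M := by
    refine ⟨⟨hWfin.toFinset, ?_⟩⟩
    rw [hWfin.coe_toFinset, eq_top_iff]
    intro x _
    refine hW (Submodule.span A W).toAddSubgroup Submodule.subset_span ?_ ?_ x
    · intro c x hx
      have := Submodule.smul_mem _ (MvPolynomial.C c : A) hx
      rwa [smul_def, show ψ (MvPolynomial.C c) = MvPolynomial.C c from
        MvPolynomial.aeval_C _ _] at this
    · intro f hf x hx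
      obtain ⟨i, rfl⟩ := List.get_of_mem hf
      have := Submodule.smul_mem _ (MvPolynomial.X i : A) hx
      rwa [smul_def, show ψ (MvPolynomial.X i) = fs.get i from MvPolynomial.aeval_X _ _] at this
  let J := Module.annihilator (PolyRing F r) M
  have hint : ((Ideal.Quotient.mk J).comp ψ.toRingHom).IsIntegral := by
    intro q
    obtain ⟨q, rfl⟩ := Ideal.Quotient.mk_surjective q
    let L : Module.End A M :=
      { toFun := fun x => q • x
        map_add' := smul_add q
        map_smul' := fun a x => by
          rw [RingHom.id_apply, smul_def, smul_def, smul_comm] }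
    obtain ⟨p, hp, hpL⟩ := LinearMap.exists_monic_and_aeval_eq_zero A L
    refine ⟨p, hp, ?_⟩
    rw [← Polynomial.hom_eval₂, Ideal.Quotient.eq_zero_iff_mem, Module.mem_annihilator]
    intro m
    have h1 : ∀ p : Polynomial A, p.eval₂ ψ.toRingHom q • m = Polynomial.aeval L p m := by
      intro p
      induction p using Polynomial.induction_on' with
      | add p p' hp hp' => rw [Polynomial.eval₂_add, add_smul, hp, hp', map_add, LinearMap.add_apply]
      | monomial n a =>
        have h2 : ∀ n : ℕ, (L ^ n) m = q ^ n • m := by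
          intro n
          induction n with
          | zero => rw [pow_zero, pow_zero, one_smul]; rfl
          | succ n ih =>
            rw [pow_succ', Module.End.mul_apply, ih, pow_succ', mul_smul]
            rfl
        rw [Polynomial.eval₂_monomial, Polynomial.aeval_monomial, Module.End.mul_apply, h2,
          Module.algebraMap_end_apply, smul_def, mul_smul]
        rfl
    rw [h1, hpL, LinearMap.zero_apply]
  rw [Module.supportDim_eq_ringKrullDim_quotient_annihilator]
  refine (ringKrullDim_le_of_isIntegral _ hint).trans ?_
  rw [MvPolynomial.ringKrullDim_of_isNoetherianRing, ringKrullDim_eq_zero_of_field, zero_add,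
    Nat.card_fin]

end

/-! ### Upper and lower bounds for `M ⧸ I ^ t M` -/

section

open scoped Pointwise

section

variable {F : Type*} [Field F] {r : ℕ} {M : Type*} [AddCommGroup M] [Module (PolyRing F r) M]
  {𝓜 : ℤ → AddSubgroup M}

theorem IsGrading.exists_forall_mem_pow_smul_top (h : IsGrading (F := F) (r := r) 𝓜) {d : ℕ}
    {s : Set (PolyRing F r)} (hs : ∀ f ∈ s, f.IsHomogeneous d)
    (hI : ∃ k : ℤ, ∀ j, k ≤ j → ∀ x ∈ 𝓜 j, x ∈ Ideal.span s • (⊤ : Submodule (PolyRing F r) M))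
    (t : ℕ) : ∃ k : ℤ, ∀ j, k ≤ j → ∀ x ∈ 𝓜 j,
      x ∈ Ideal.span s ^ t • (⊤ : Submodule (PolyRing F r) M) := by
  obtain ⟨k, hk⟩ := hI
  induction t with
  | zero => exact ⟨0, fun j _ x _ => by simp⟩
  | succ t ih =>
    obtain ⟨l, hl⟩ := ih
    refine ⟨max k (l + d), fun j hj x hx => ?_⟩
    have h1 := h.mem_closure_of_mem_span_smul hs (hk j (le_of_max_le_left hj) x hx) hx
    refine (AddSubgroup.closure_le
      (Ideal.span s ^ (t + 1) • (⊤ : Submodule (PolyRing F r) M)).toAddSubgroup).2 ?_ h1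
    rintro _ ⟨f, hf, m, hm, rfl⟩
    rw [pow_succ', Submodule.mul_smul]
    exact Submodule.smul_mem_smul (Ideal.subset_span hf)
      (hl _ (by have := le_of_max_le_right hj; omega) m hm)

theorem irrelevantTorsion_of_bounded (h : IsGrading (F := F) (r := r) 𝓜) {k : ℤ}
    (hk : ∀ j, k ≤ j → ∀ x ∈ 𝓜 j, x = 0) {j : ℤ} {x : M} (hx : x ∈ 𝓜 j) :
    x ∈ irrelevantTorsion F r M :=
  mem_irrelevantTorsion.2 ⟨(k - j).toNat, fun a ha p hp =>
    hk _ (by omega) _ (h.smul_mem a j p x hp hx)⟩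

theorem forall_quotientGrading_eq_zero {N : Submodule (PolyRing F r) M} {j : ℤ}
    (hj : ∀ x ∈ 𝓜 j, x ∈ N) : ∀ x ∈ quotientGrading 𝓜 N j, x = 0 := by
  rintro _ ⟨x, hx, rfl⟩
  exact (Submodule.Quotient.mk_eq_zero N).2 (hj x hx)

/-- For a module that vanishes in large degrees, regularity bounds all degrees. -/
theorem Kreg.eq_zero_of_bounded {c : ℤ} (hc : Kreg F r 𝓜 c) (h : IsGrading (F := F) (r := r) 𝓜)
    (hk : ∃ k : ℤ, ∀ j, k ≤ j → ∀ x ∈ 𝓜 j, x = 0) {j : ℤ} (hj : c < j) : ∀ x ∈ 𝓜 j, x = 0 := by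
  obtain ⟨k, hk⟩ := hk
  exact fun x hx => hc.eq_zero_of_mem_irrelevantTorsion h hj hx (irrelevantTorsion_of_bounded h hk hx)

theorem eq_zero_or_isUnit_of_isHomogeneous_zero {f : PolyRing F r} (hf : f.IsHomogeneous 0) :
    f = 0 ∨ IsUnit f := by
  rw [MvPolynomial.totalDegree_eq_zero_iff_eq_C.1
    ((MvPolynomial.totalDegree_zero_iff_isHomogeneous _).2 hf)]
  by_cases h0 : f.coeff 0 = 0
  · exact Or.inl (by rw [h0, map_zero])
  · exact Or.inr ((isUnit_iff_ne_zero.2 h0).map MvPolynomial.C)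

/-- The upper bound, in terms of Koszul homology. The quotient lives in bounded degrees only, so its
regularity is bounded by its largest degree. -/
theorem Kreg.quotient_pow_smul_top [Module.Finite (PolyRing F r) M]
    (h : IsGrading (F := F) (r := r) 𝓜) {n : ℕ}
    (hn : Module.supportDim (PolyRing F r) M = (n : WithBot ℕ∞)) {d : ℕ}
    {s : Set (PolyRing F r)} (hs : ∀ f ∈ s, f.IsHomogeneous d)
    (hI : ∃ k : ℤ, ∀ j, k ≤ j → ∀ x ∈ 𝓜 j, x ∈ Ideal.span s • (⊤ : Submodule (PolyRing F r) M))
    {t : ℕ} (ht : 0 < t) {c : ℤ} (hc : Kreg F r 𝓜 c) :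
    Kreg F r (quotientGrading 𝓜 (Ideal.span s ^ t • (⊤ : Submodule (PolyRing F r) M)))
      (c + (t * d + ((n : ℤ) - 1) * (d - 1) - 1)) := by
  refine Kreg.of_forall_eq_zero fun j hj => forall_quotientGrading_eq_zero ?_
  rcases Nat.eq_zero_or_pos d with rfl | hd
  · -- In degree `0` the ideal is generated by constants, so it is `0` or the whole ring.
    by_cases hs0 : ∃ f ∈ s, f ≠ 0
    · obtain ⟨f, hf, hf0⟩ := hs0
      have htop : Ideal.span s = ⊤ := by
        exact Ideal.eq_top_of_isUnit_mem _ (Ideal.subset_span hf)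
          ((eq_zero_or_isUnit_of_isHomogeneous_zero (hs f hf)).resolve_left hf0)
      intro x _
      rw [htop, Ideal.top_pow, Submodule.top_smul]
      trivial
    · have hbot : Ideal.span s = ⊥ := by
        rw [Ideal.span_eq_bot]
        intro f hf
        by_contra h0
        exact hs0 ⟨f, hf, h0⟩
      have hk : ∃ k : ℤ, ∀ j, k ≤ j → ∀ x ∈ 𝓜 j, x = 0 := by
        obtain ⟨k, hk⟩ := hI
        refine ⟨k, fun j hj x hx => ?_⟩
        have := hk j hj x hx
        rwa [hbot, Submodule.bot_smul, Submodule.mem_bot] at this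
      have hn0 : n = 0 := by
        have h1 := h.supportDim_le_length Nat.one_pos [] (by simp) (by
          obtain ⟨k, hk⟩ := hk
          exact ⟨k, fun j hj x hx => by rw [hk j hj x hx]; exact zero_mem _⟩)
        rw [hn] at h1
        have h2 : n ≤ ([] : List (PolyRing F r)).length := by exact_mod_cast h1
        simpa using h2
      subst hn0
      intro x hx
      rw [hc.eq_zero_of_bounded h hk (j := j) (by simpa using hj) x hx]
      exact zero_mem _
  · refine mem_pow_smul_top hd hs (n := n + 1) h ?_ hc hI ht ?_
    · rw [hn]
      exact_mod_cast Nat.lt_succ_self n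
    · refine lt_of_eq_of_lt ?_ hj
      push_cast
      ring

/-- If `y` kills `M`, then `(y, J)^t M = J^t M`. -/
theorem sup_pow_smul_top_le {y : PolyRing F r} (hy : ∀ x : M, y • x = 0) (J : Ideal (PolyRing F r))
    (t : ℕ) : (Ideal.span {y} ⊔ J) ^ t • (⊤ : Submodule (PolyRing F r) M) ≤ J ^ t • ⊤ := by
  induction t with
  | zero => simp
  | succ t ih =>
    rw [pow_succ', pow_succ', Submodule.mul_smul, Submodule.mul_smul]
    refine (Submodule.smul_mono le_rfl ih).trans ?_
    rw [Submodule.sup_smul]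
    refine sup_le ?_ le_rfl
    rw [Submodule.smul_le]
    intro a ha x _
    obtain ⟨b, rfl⟩ := Ideal.mem_span_singleton'.1 ha
    rw [mul_smul, hy, smul_zero]
    exact zero_mem _

/-- Along a regular sequence `fs` of forms of degree `d`, a bound for the degrees of `M ⧸ (fs) ^ t M`
bounds the regularity of `M`: cut down by all elements but the last, and by the `t`-th power of the
last one. -/
theorem kreg_of_isWeaklyRegular {d : ℕ} (hd : 0 < d) {t : ℕ} (ht : 0 < t) {C : ℤ}
    (f : PolyRing F r) (fs : List (PolyRing F r)) :
    ∀ {M : Type*} [AddCommGroup M] [Module (PolyRing F r) M] {𝓜 : ℤ → AddSubgroup M}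
      (_ : IsGrading (F := F) (r := r) 𝓜) (_ : ∀ g ∈ f :: fs, g.IsHomogeneous d)
      (_ : RingTheory.Sequence.IsWeaklyRegular M (f :: fs))
      (_ : ∀ j, C < j → ∀ x ∈ 𝓜 j,
        x ∈ Ideal.ofList (f :: fs) ^ t • (⊤ : Submodule (PolyRing F r) M)),
      Kreg F r 𝓜 (C - (t * d - 1) - fs.length * (d - 1)) := by
  induction fs generalizing f with
  | nil =>
    intro M _ _ 𝓜 h hhom hreg htop
    rw [RingTheory.Sequence.isWeaklyRegular_cons_iff] at hreg
    have hf := hhom f (List.mem_cons_self)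
    have h1 : Kreg F r (quotientGrading 𝓜 (f ^ t • (⊤ : Submodule (PolyRing F r) M))) C := by
      refine Kreg.of_forall_eq_zero fun j hj => forall_quotientGrading_eq_zero fun x hx => ?_
      have := htop j hj x hx
      rwa [Ideal.ofList_singleton, Ideal.span_singleton_pow,
        Submodule.ideal_span_singleton_smul] at this
    have h2 := Kreg.of_quotient_smul_top h (Nat.mul_pos hd ht) (hf.pow t) (hreg.1.pow t) h1
    refine h2.mono (le_of_eq ?_)
    simp only [List.length_nil]
    push_cast
    ring
  | cons g fs ih =>
    intro M _ _ 𝓜 h hhom hreg htop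
    rw [RingTheory.Sequence.isWeaklyRegular_cons_iff] at hreg
    have hf := hhom f (List.mem_cons_self)
    have hy : ∀ x : M ⧸ (f • (⊤ : Submodule (PolyRing F r) M)), f • x = 0 := by
      intro x
      obtain ⟨x, rfl⟩ := Submodule.mkQ_surjective _ x
      exact (Submodule.Quotient.mk_eq_zero _).2 (Submodule.smul_mem_pointwise_smul _ _ _ trivial)
    have h1 := ih g (h.quotient (h.homogeneous_smul_top hf))
      (fun k hk => hhom k (List.mem_cons_of_mem _ hk)) hreg.2 (fun j hj x hx => by
        have := forall_mem_smul_top_quotient (htop j hj) x hx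
        rw [Ideal.ofList_cons f] at this
        exact sup_pow_smul_top_le hy _ t this)
    refine (Kreg.of_quotient_smul_top h hd hf hreg.1 h1).mono (le_of_eq ?_)
    simp only [List.length_cons]
    push_cast
    ring

end

end

end GradedReg

end

theorem mainTheorem7 {F : Type*} [Field F] (r : ℕ)
    {M : Type*} [AddCommGroup M] [Module (GradedReg.PolyRing F r) M]
    [Module.Finite (GradedReg.PolyRing F r) M]
    (𝓜 : ℤ → AddSubgroup M) (h𝓜 : GradedReg.IsGrading (F := F) (r := r) 𝓜)
    (n : ℕ) (hn : Module.supportDim (GradedReg.PolyRing F r) M = (n : WithBot ℕ∞))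
    (d : ℕ) (I : Ideal (GradedReg.PolyRing F r))
    (hI : ∃ s : Set (GradedReg.PolyRing F r), (∀ f ∈ s, f.IsHomogeneous d) ∧ I = Ideal.span s)
    (hfin : IsFiniteLength (GradedReg.PolyRing F r)
      (M ⧸ (I • (⊤ : Submodule (GradedReg.PolyRing F r) M)))) :
    (∀ t : ℕ, 0 < t →
      GradedReg.regularity F r
          (GradedReg.quotientGrading 𝓜 (I ^ t • (⊤ : Submodule (GradedReg.PolyRing F r) M)))
        ≤ GradedReg.regularity F r 𝓜
          + (((t : ℝ) * d + ((n : ℝ) - 1) * ((d : ℝ) - 1) - 1 : ℝ) : EReal)) ∧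
    (∀ fs : List (GradedReg.PolyRing F r), fs ≠ [] → (∀ f ∈ fs, f.IsHomogeneous d) →
      I = Ideal.ofList fs → RingTheory.Sequence.IsRegular M fs →
      ∀ t : ℕ, 0 < t →
        GradedReg.regularity F r
            (GradedReg.quotientGrading 𝓜 (I ^ t • (⊤ : Submodule (GradedReg.PolyRing F r) M)))
          = GradedReg.regularity F r 𝓜
            + (((t : ℝ) * d + ((n : ℝ) - 1) * ((d : ℝ) - 1) - 1 : ℝ) : EReal)) := by
  obtain ⟨s, hs, rfl⟩ := hI
  have hk := h𝓜.exists_forall_mem_smul_top hs hfin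
  have hcast : ∀ t : ℕ, ((t : ℝ) * d + ((n : ℝ) - 1) * ((d : ℝ) - 1) - 1 : ℝ) =
      ((t * d + ((n : ℤ) - 1) * (d - 1) - 1 : ℤ) : ℝ) := fun t => by push_cast; ring
  have hquot := fun t => h𝓜.quotient (h𝓜.homogeneous_pow_smul_top hs t)
  have upper : ∀ t : ℕ, 0 < t →
      GradedReg.regularity F r (GradedReg.quotientGrading 𝓜
          (Ideal.span s ^ t • (⊤ : Submodule (GradedReg.PolyRing F r) M)))
        ≤ GradedReg.regularity F r 𝓜
          + (((t : ℝ) * d + ((n : ℝ) - 1) * ((d : ℝ) - 1) - 1 : ℝ) : EReal) := by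
    intro t ht
    rw [hcast]
    exact GradedReg.regularity_le_add h𝓜 (hquot t) _ fun c hc =>
      hc.quotient_pow_smul_top h𝓜 hn hs hk ht
  refine ⟨upper, fun fs hne hfs hI hreg t ht => le_antisymm (upper t ht) ?_⟩
  have hd : 0 < d := by
    rw [Nat.pos_iff_ne_zero]
    rintro rfl
    obtain ⟨f, fs, rfl⟩ := List.exists_cons_of_ne_nil hne
    rcases GradedReg.eq_zero_or_isUnit_of_isHomogeneous_zero (hfs f List.mem_cons_self)
      with rfl | hu
    · have := hreg.nontrivial
      have h0 := ((RingTheory.Sequence.isWeaklyRegular_cons_iff _ _ _).1 hreg.1).1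
      obtain ⟨x, hx⟩ := exists_ne (0 : M)
      exact hx (h0.right_eq_zero_of_smul (zero_smul _ x))
    · refine hreg.2 ?_
      rw [Ideal.eq_top_of_isUnit_mem (Ideal.ofList (f :: fs))
        (Ideal.subset_span (show f ∈ {g | g ∈ f :: fs} from List.mem_cons_self)) hu,
        Submodule.top_smul]
  have hlen : n ≤ fs.length := by
    have := h𝓜.supportDim_le_length hd fs hfs (by rwa [← hI])
    rw [hn] at this
    exact_mod_cast this
  obtain ⟨f, fs, rfl⟩ := List.exists_cons_of_ne_nil hne
  rw [hcast]
  have lower := GradedReg.regularity_le_add (hquot t) h𝓜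
    (-(t * d + ((n : ℤ) - 1) * (d - 1) - 1)) fun C hC => by
      have hzero : ∀ j, C < j → ∀ x ∈ 𝓜 j,
          x ∈ Ideal.ofList (f :: fs) ^ t • (⊤ : Submodule (GradedReg.PolyRing F r) M) := by
        intro j hj x hx
        rw [← hI, ← Submodule.Quotient.mk_eq_zero]
        refine hC.eq_zero_of_bounded (hquot t) ?_ hj _ ⟨x, hx, rfl⟩
        obtain ⟨k, hk⟩ := h𝓜.exists_forall_mem_pow_smul_top hs hk t
        exact ⟨k, fun j hj => GradedReg.forall_quotientGrading_eq_zero (hk j hj)⟩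
      refine (GradedReg.kreg_of_isWeaklyRegular hd ht f fs h𝓜 hfs hreg.1 hzero).mono ?_
      have h1 : (n : ℤ) ≤ fs.length + 1 := by exact_mod_cast hlen
      have h2 : (1 : ℤ) ≤ d := by exact_mod_cast hd
      nlinarith [mul_nonneg (sub_nonneg.2 h1) (sub_nonneg.2 h2)]
  rw [Int.cast_neg, EReal.coe_neg, ← sub_eq_add_neg] at lower
  exact (EReal.le_sub_iff_add_le (Or.inl (EReal.coe_ne_bot _)) (Or.inl (EReal.coe_ne_top _))).1 lower
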